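/- Let $n\ge 1$; all functions on $\mathbb R^n$ are real-valued (or all are complex-valued). For $b\in L^1_{\mathrm{loc}}(\mathbb R^n)$ and a ball $B$ of radius $r(B)$ put $c_B=\frac1{|B|}\int_B b$ if $r(B)<1$ and $c_B=0$ if $r(B)\ge 1$; let $\|b\|_{\mathrm{bmo}}=\sup_B\frac1{|B|}\int_B|b(x)-c_B|\,dx$, the supremum being over all balls, and write $b\in\mathrm{bmo}(\mathbb R^n)$ if this is finite. For a locally integrable $f$ let $$\mathcal M f(x)=\sup_\phi\left|\int f\phi\right|,\qquad \|f\|_{h^1}=\|\mathcal M f\|_{L^1(\mathbb R^n)}\in[0,\infty],$$ where the supremum is over all $\phi\in C^1(\mathbb R^n)$ such that, for some $0<t<1$, $\operatorname{supp}\phi\subset B(x,t)$, $\|\phi\|_{L^\infty}\le|B(x,t)|^{-1}$ and $\|\nabla\phi\|_{L^\infty}\le[t|B(x,t)|]^{-1}$. For $b,f\in L^2_{\mathrm{loc}}(\mathbb R^n)$ let $\mathcal M_b f(x)=\mathcal M[b(x)f(\cdot)-b(\cdot)f(\cdot)](x)$. An $h^1$ atom with respect to the ball $B=B(x_0,r)$,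 $r>0$, is a measurable function $a$ supported in $B$ with $\|a\|_{L^2}\le|B|^{-1/2}$ and $\left|\int a\right|\le[\log(1+r^{-1})]^{-1}$. Then there is a constant $C$ depending only on $n$ such that, for every $b\in\mathrm{bmo}(\mathbb R^n)$ and every $h^1$ atom $a$ with respect to a ball $B=B(x_0,r)$ that satisfies $\int a=0$ in case $r<1$, $$\|\mathcal M_b a\|_{L^1}\le C\left(\|a(b-c_B)\|_{h^1}+\|b\|_{\mathrm{bmo}}\right),\qquad \|a(b-c_B)\|_{h^1}+\|b\|_{\mathrm{bmo}}\le C\left(\|\mathcal M_b a\|_{L^1}+\|b\|_{\mathrm{bmo}}\right).$$ Moreover, $ab$ is integrable and $$\left|\int ab\right|\le C\min\left\{\frac{\|\mathcal M_b a\|_{L^1}+\|b\|_{\mathrm{bmo}}}{\log(1+r^{-1})},\ \|b\|_{\mathrm{bmo}}\right\}.$$ -/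

import Mathlib

open MeasureTheory Metric
open scoped ENNReal

namespace LocalHardy

/-- Euclidean space of dimension `n`. -/
abbrev Rn (n : ℕ) : Type := EuclideanSpace ℝ (Fin n)

noncomputable section

/-- The constant `c_B` attached to `b` and the ball `B = B(x₀, r)`: the mean of `b` over `B` if
`r < 1`, and `0` if `r ≥ 1`. -/
def bmoConst {𝕜 : Type*} [RCLike 𝕜] {n : ℕ} (b : Rn n → 𝕜) (x₀ : Rn n) (r : ℝ) : 𝕜 :=
  if r < 1 then ⨍ y in ball x₀ r, b y else 0

/-- The norm of the nonhomogeneous space bmo: the supremum over all balls `B` of the mean over `B`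
of `|b - c_B|`. -/
def bmoNorm {𝕜 : Type*} [RCLike 𝕜] {n : ℕ} (b : Rn n → 𝕜) : ℝ≥0∞ :=
  ⨆ (x₀ : Rn n) (r : ℝ) (_ : 0 < r), ⨍⁻ y in ball x₀ r, ‖b y - bmoConst b x₀ r‖ₑ ∂volume

/-- Membership in bmo. -/
def MemBmo {𝕜 : Type*} [RCLike 𝕜] {n : ℕ} (b : Rn n → 𝕜) : Prop :=
  LocallyIntegrable b volume ∧ bmoNorm b < ∞

/-- The test functions attached to the ball `B(x, t)`: those of class `C¹`, with (closed) support
in `B(x, t)`, bounded by `1 / |B(x, t)|`, and with gradient bounded by `1 / (t |B(x, t)|)`. -/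
def IsTestFun {𝕜 : Type*} [RCLike 𝕜] {n : ℕ} (x : Rn n) (t : ℝ) (φ : Rn n → 𝕜) : Prop :=
  ContDiff ℝ 1 φ ∧ tsupport φ ⊆ ball x t ∧
    (∀ y, ‖φ y‖ ≤ (volume.real (ball x t))⁻¹) ∧
    (∀ y, ‖fderiv ℝ φ y‖ ≤ (t * volume.real (ball x t))⁻¹)

/-- The local grand maximal function (at scales `0 < t < 1`) of a locally integrable function. -/
def grandMax {𝕜 : Type*} [RCLike 𝕜] {n : ℕ} (f : Rn n → 𝕜) (x : Rn n) : ℝ≥0∞ :=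
  ⨆ (t : ℝ) (_ : 0 < t ∧ t < 1) (φ : Rn n → 𝕜) (_ : IsTestFun x t φ), ‖∫ y, f y * φ y‖ₑ

/-- The norm of the local Hardy space `h¹`: the `L¹` norm of the local grand maximal function. -/
def hardyNorm {𝕜 : Type*} [RCLike 𝕜] {n : ℕ} (f : Rn n → 𝕜) : ℝ≥0∞ :=
  ∫⁻ x, grandMax f x

/-- The commutator maximal function: at `x`, the grand maximal function of
`b(x) f(·) - b(·) f(·)`, evaluated at `x`. -/
def commMax {𝕜 : Type*} [RCLike 𝕜] {n : ℕ} (b f : Rn n → 𝕜) (x : Rn n) : ℝ≥0∞ :=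
  grandMax (fun y => b x * f y - b y * f y) x

/-- `a` is an `h¹` atom, that is an approximate `(1, 2)` atom, with respect to the ball `B(x₀, r)`.
Functions are considered up to null sets, so the support condition reads `a = 0` almost everywhere
outside the ball. -/
structure IsAtom {𝕜 : Type*} [RCLike 𝕜] {n : ℕ} (a : Rn n → 𝕜) (x₀ : Rn n) (r : ℝ) : Prop where
  aestronglyMeasurable : AEStronglyMeasurable a volume
  radius_pos : 0 < r
  support : ∀ᵐ y, y ∉ ball x₀ r → a y = 0
  size : eLpNorm a 2 volume ≤ volume (ball x₀ r) ^ (-(1 / 2) : ℝ)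
  cancel : ‖∫ y, a y‖ ≤ (Real.log (1 + r⁻¹))⁻¹

end

end LocalHardy

namespace LocalHardy

/-! With c = c_B, linearity of the pairing with a test function gives b(x)a - ba = (b(x) - c)a - a(b
- c). Hence `commMax b a` and the grand maximal function of a(b - c) differ pointwise by at most
|b(x) - c| times the grand maximal function of a, and both norm inequalities reduce to bounding the
integral of this product by a multiple of the bmo norm (`lintegral_enorm_sub_mul_grandMax_le`).

On the double ball 2B this is Cauchy–Schwarz: the L² form of John–Nirenberg
(`lintegral_sq_le_of_lintegral_le`) for b - c, and the L² boundedness of the grand maximal function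
(`lintegral_grandMax_sq_le`) for a. Outside 2B the cancellation of a gains a factor 2^(-j) on the
j-th dyadic shell (`IsAtom.grandMax_le`), while the mean of |b - c| grows only linearly in j, so the
shells sum.

For the integral of ab, one has ∫ab = ∫a(b - c), because either ∫a = 0 or c = 0. Cauchy–Schwarz and
John–Nirenberg bound this by the bmo norm. The logarithmic gain comes from
`exists_log_mul_enorm_integral_le`: a function f supported in B has a grand maximal function of size
at least about |∫f|/|x - x₀|^n on each dyadic annulus between radius r and a fixed scale, and there
are about log(1/r) such annuli. -/

lemma volume_ball_mul {n : ℕ} (x y : Rn n) {k : ℕ} (hk : k ≠ 0) (r : ℝ) :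
    volume (ball y (k * r)) = (k : ℝ≥0∞) ^ n * volume (ball x r) := by
  rw [Measure.addHaar_ball_mul_of_pos volume y (by positivity : (0 : ℝ) < k) r,
    Measure.addHaar_ball_center volume x r, finrank_euclideanSpace_fin,
    ENNReal.ofReal_pow (by positivity), ENNReal.ofReal_natCast]

lemma volume_ball_eq {n : ℕ} (x y : Rn n) (r : ℝ) : volume (ball x r) = volume (ball y r) := by
  rw [Measure.addHaar_ball_center volume x r, Measure.addHaar_ball_center volume y r]

lemma volume_ball_ne_zero {n : ℕ} (x : Rn n) {r : ℝ} (hr : 0 < r) : volume (ball x r) ≠ 0 :=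
  (measure_ball_pos volume x hr).ne'

lemma volume_ball_ne_top {n : ℕ} (x : Rn n) (r : ℝ) : volume (ball x r) ≠ ∞ :=
  measure_ball_lt_top.ne

/-! ### Covering and differentiation -/

/-- Vitali covering: a set `S` of centres of balls on each of which `g` has mean at least `lam` is
covered by countably many dilated balls of small total volume. -/
lemma exists_countable_cover_of_mean_ge {n : ℕ} {g : Rn n → ℝ≥0∞} {S U : Set (Rn n)}
    {s : Rn n → ℝ} {R : ℝ} {lam : ℝ≥0∞}
    (hS : ∀ x ∈ S, 0 < s x ∧ s x ≤ R ∧ ball x (s x) ⊆ U ∧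
      lam * volume (ball x (s x)) ≤ ∫⁻ y in ball x (s x), g y) :
    ∃ u ⊆ S, u.Countable ∧ S ⊆ ⋃ x ∈ u, ball x (6 * s x) ∧
      lam * ∑' x : u, volume (ball (x : Rn n) (6 * s x)) ≤ 6 ^ n * ∫⁻ y in U, g y := by
  obtain ⟨u, huS, hdisj, hcov⟩ := Vitali.exists_disjoint_subfamily_covering_enlargement_ball
    S id s R (fun x hx => (hS x hx).2.1) 6 (by norm_num)
  simp only [id] at hdisj hcov
  have huc : u.Countable := by
    refine hdisj.countable_of_isOpen (fun x _ => isOpen_ball) fun x hx => ?_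
    exact ⟨x, mem_ball_self (hS x (huS hx)).1⟩
  refine ⟨u, huS, huc, fun x hx => ?_, ?_⟩
  · obtain ⟨z, hz, hsub⟩ := hcov x hx
    exact Set.mem_biUnion hz (hsub (mem_ball_self (hS x hx).1))
  · calc lam * ∑' x : u, volume (ball (x : Rn n) (6 * s x))
        = 6 ^ n * ∑' x : u, lam * volume (ball (x : Rn n) (s x)) := by
          rw [← ENNReal.tsum_mul_left, ← ENNReal.tsum_mul_left]
          refine tsum_congr fun x => ?_
          have := volume_ball_mul (x : Rn n) x (k := 6) (by norm_num) (s x)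
          push_cast at this
          rw [this]; ring
      _ ≤ 6 ^ n * ∑' x : u, ∫⁻ y in ball (x : Rn n) (s x), g y := by
          gcongr with x
          exact (hS x (huS x.2)).2.2.2
      _ = 6 ^ n * ∫⁻ y in ⋃ x ∈ u, ball x (s x), g y := by
          rw [lintegral_biUnion huc (fun x _ => measurableSet_ball) hdisj]
      _ ≤ 6 ^ n * ∫⁻ y in U, g y := by
          gcongr
          exact Set.iUnion₂_subset fun x hx => (hS x (huS hx)).2.2.1

open Filter Topology in
/-- Lebesgue differentiation: if the means of `g` over all small balls centred at `x` are at most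
`lam`, then `g x ≤ lam` for almost every such `x` in the set where `g` is integrable. -/
lemma ae_le_of_lintegral_ball_le {n : ℕ} {g : Rn n → ℝ≥0∞} {lam : ℝ≥0∞} {x₀ : Rn n} {R : ℝ}
    (hg : AEMeasurable g) (hfin : ∫⁻ y in ball x₀ (2 * R), g y ≠ ∞) :
    ∀ᵐ x, x ∈ ball x₀ R →
      (∀ s, 0 < s → s < R → ∫⁻ y in ball x s, g y ≤ lam * volume (ball x s)) → g x ≤ lam := by
  have hfin' : ∫⁻ y, (ball x₀ (2 * R)).indicator g y ≠ ∞ := by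
    rwa [lintegral_indicator measurableSet_ball]
  filter_upwards [(Besicovitch.vitaliFamily (volume : Measure (Rn n))).ae_tendsto_lintegral_div
    (hg.indicator measurableSet_ball) hfin'] with x hx hxB hmean
  have hxB' := mem_ball.1 hxB
  have hR : 0 < R := dist_nonneg.trans_lt hxB'
  have hval : (ball x₀ (2 * R)).indicator g x = g x :=
    Set.indicator_of_mem (ball_subset_ball (by linarith) hxB) _
  rw [hval] at hx
  refine le_of_tendsto (hx.comp (Besicovitch.tendsto_filterAt volume x)) ?_
  filter_upwards [Ioo_mem_nhdsGT hR] with s hs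
  simp only [Function.comp_apply]
  -- The differentiation basis consists of closed balls; spheres are null.
  have hae : (closedBall x s : Set (Rn n)) =ᵐ[volume] ball x s := by
    rw [← ball_union_sphere]
    have hs0 : volume (sphere x s) = 0 := Measure.addHaar_sphere_of_ne_zero volume x hs.1.ne'
    exact union_ae_eq_left_of_ae_eq_empty (measure_eq_zero_iff_ae_notMem.1 hs0 |>.mono fun y hy => by
      exact propext ⟨fun h => hy h, fun h => h.elim⟩)
  rw [measure_congr hae, Measure.restrict_congr_set hae]
  refine ENNReal.div_le_of_le_mul (le_trans ?_ (hmean s hs.1 hs.2))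
  exact lintegral_mono fun y => Set.indicator_le_self _ _ _

/-! ### Mean oscillation and the John–Nirenberg inequality in L² -/

lemma enorm_sub_mul_volume_le {n : ℕ} {F : Type*} [NormedAddCommGroup F] {b : Rn n → F}
    (hb : AEStronglyMeasurable b) (c c' : F) (S : Set (Rn n)) :
    ‖c - c'‖ₑ * volume S ≤ (∫⁻ y in S, ‖b y - c‖ₑ) + ∫⁻ y in S, ‖b y - c'‖ₑ := by
  have hm : AEMeasurable (fun y => ‖b y - c‖ₑ) (volume.restrict S) :=
    (hb.restrict.sub aestronglyMeasurable_const).enorm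
  rw [← lintegral_add_left' hm, ← setLIntegral_const]
  refine lintegral_mono fun y => ?_
  have : c - c' = (b y - c') - (b y - c) := by abel
  rw [this, add_comm]
  exact enorm_sub_le

/-- The constants attached to two nested balls of comparable volume are comparable. -/
lemma enorm_sub_le_of_ball_subset {n : ℕ} {F : Type*} [NormedAddCommGroup F] {b : Rn n → F}
    (hb : AEStronglyMeasurable b) {c c' : F} {A k : ℝ≥0∞} {S S' : Set (Rn n)}
    (hSS : S ⊆ S') (h0 : volume S ≠ 0) (htop : volume S ≠ ∞)
    (hk : volume S' ≤ k * volume S)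
    (h : ∫⁻ y in S, ‖b y - c‖ₑ ≤ A * volume S) (h' : ∫⁻ y in S', ‖b y - c'‖ₑ ≤ A * volume S') :
    ‖c - c'‖ₑ ≤ (1 + k) * A := by
  rw [← ENNReal.mul_le_mul_iff_left h0 htop]
  calc ‖c - c'‖ₑ * volume S ≤ (∫⁻ y in S, ‖b y - c‖ₑ) + ∫⁻ y in S, ‖b y - c'‖ₑ :=
        enorm_sub_mul_volume_le hb c c' S
    _ ≤ A * volume S + A * (k * volume S) := by
        gcongr
        exact (lintegral_mono_set hSS).trans (h'.trans (by gcongr))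
    _ = (1 + k) * A * volume S := by ring

lemma ennreal_add_sq_le (u v : ℝ≥0∞) : (u + v) ^ 2 ≤ 2 * u ^ 2 + 2 * v ^ 2 := by
  have h := ENNReal.rpow_add_le_mul_rpow_add_rpow u v (p := 2) (by norm_num)
  norm_num at h
  rw [← mul_add]; exact_mod_cast h

lemma min_add_le_min_add (u v N : ℝ≥0∞) : min (u + v) N ≤ min u N + v := by
  rcases le_total u N with h | h
  · rw [min_eq_left h]; exact min_le_left _ _
  · rw [min_eq_right h]; exact (min_le_right _ _).trans le_self_add

/-- Calderón–Zygmund type covering at height `L * A`: outside a countable union of balls of small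
total volume `b - c` is bounded, and on each of these balls its mean is bounded. -/
lemma exists_calderon_zygmund_cover {n : ℕ} {F : Type*} [NormedAddCommGroup F] {b : Rn n → F}
    (hb : AEStronglyMeasurable b) {c : Rn n → ℝ → F} {A : ℝ≥0∞} (hA0 : A ≠ 0) (hA : A ≠ ∞)
    (h : ∀ x r, 0 < r → ∫⁻ y in ball x r, ‖b y - c x r‖ₑ ≤ A * volume (ball x r))
    (x₀ : Rn n) {R : ℝ} (hR : 0 < R) :
    ∃ (u : Set (Rn n)) (s : Rn n → ℝ), u.Countable ∧ (∀ x ∈ u, 0 < s x ∧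
        ∫⁻ y in ball x (s x), ‖b y - c x₀ R‖ₑ ≤
          (4 * 6 ^ n * (2 ^ n * (2 + 2 ^ n))) * A * volume (ball x (s x))) ∧
      4 * ∑' x : u, volume (ball (x : Rn n) (s x)) ≤ volume (ball x₀ R) ∧
      ∀ᵐ y, y ∈ ball x₀ R → y ∉ ⋃ x ∈ u, ball x (s x) →
        ‖b y - c x₀ R‖ₑ ≤ (4 * 6 ^ n * (2 ^ n * (2 + 2 ^ n))) * A := by
  -- `M * A` bounds the integral of |b - c| over the double ball, relative to |B|. In the height
  -- `lam`, the factor 6^n pays for the Vitali enlargement and the 4 makes the selected balls fill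
  -- at most a quarter of B.
  set M : ℝ≥0∞ := 2 ^ n * (2 + 2 ^ n) with hM
  set g : Rn n → ℝ≥0∞ := fun y => ‖b y - c x₀ R‖ₑ with hg
  set lam : ℝ≥0∞ := (4 * 6 ^ n * M) * A with hlam
  have hMtop : M ≠ ∞ := by finiteness
  have hM0 : M ≠ 0 := by positivity
  have hgm : AEMeasurable g := (hb.sub aestronglyMeasurable_const).enorm
  have hB0 := volume_ball_ne_zero x₀ hR
  have hBt := volume_ball_ne_top x₀ R
  have h2B : volume (ball x₀ (2 * R)) = 2 ^ n * volume (ball x₀ R) := by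
    have := volume_ball_mul x₀ x₀ (k := 2) (by norm_num) R
    push_cast at this; exact this
  have hcc : ‖c x₀ R - c x₀ (2 * R)‖ₑ ≤ (1 + 2 ^ n) * A :=
    enorm_sub_le_of_ball_subset hb (ball_subset_ball (by linarith)) hB0 hBt h2B.le (h x₀ R hR)
      (h x₀ (2 * R) (by linarith))
  have hint : ∫⁻ y in ball x₀ (2 * R), g y ≤ M * A * volume (ball x₀ R) := by
    calc ∫⁻ y in ball x₀ (2 * R), g y
        ≤ ∫⁻ y in ball x₀ (2 * R), (‖b y - c x₀ (2 * R)‖ₑ + ‖c x₀ R - c x₀ (2 * R)‖ₑ) := by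
          refine lintegral_mono fun y => ?_
          have : b y - c x₀ R = (b y - c x₀ (2 * R)) - (c x₀ R - c x₀ (2 * R)) := by abel
          simp only [hg]; rw [this]
          exact enorm_sub_le
      _ = (∫⁻ y in ball x₀ (2 * R), ‖b y - c x₀ (2 * R)‖ₑ) +
            ‖c x₀ R - c x₀ (2 * R)‖ₑ * volume (ball x₀ (2 * R)) := by
          rw [lintegral_add_right _ measurable_const, setLIntegral_const]
      _ ≤ A * volume (ball x₀ (2 * R)) + (1 + 2 ^ n) * A * volume (ball x₀ (2 * R)) := by
          gcongr
          exact h x₀ (2 * R) (by linarith)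
      _ = M * A * volume (ball x₀ R) := by rw [h2B, hM]; ring
  have hintfin : ∫⁻ y in ball x₀ (2 * R), g y ≠ ∞ :=
    ne_top_of_le_ne_top (by finiteness) hint
  set T : Rn n → Set ℝ := fun x => {s | 0 < s ∧ s < R ∧ lam * volume (ball x s) <
    ∫⁻ y in ball x s, g y} with hT
  set S : Set (Rn n) := {x | x ∈ ball x₀ R ∧ (T x).Nonempty} with hS
  have hsub : ∀ x ∈ ball x₀ R, ∀ s, s ≤ R → ball x s ⊆ ball x₀ (2 * R) := fun x hx s hs =>
    ball_subset_ball' (by have := mem_ball.1 hx; linarith)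
  -- A ball of radius s ≥ R/6 is too large, compared with the integral over the double ball, to have
  -- mean above `lam`.
  have hsmall : ∀ x ∈ ball x₀ R, ∀ s ∈ T x, 6 * s < R := by
    intro x hx s ⟨hs0, hsR, hs⟩
    by_contra! hcon
    have h1 : lam * volume (ball x s) < M * A * volume (ball x₀ R) :=
      hs.trans_le ((lintegral_mono_set (hsub x hx s hsR.le)).trans hint)
    have h2 : volume (ball x₀ R) ≤ 6 ^ n * volume (ball x s) := by
      have := volume_ball_mul x x₀ (k := 6) (by norm_num) s
      push_cast at this
      rw [← this]
      exact measure_mono (ball_subset_ball hcon)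
    have h3 : M * A * volume (ball x₀ R) ≤ lam * volume (ball x s) := by
      calc M * A * volume (ball x₀ R) ≤ M * A * (6 ^ n * volume (ball x s)) := by gcongr
        _ = 1 * (M * A * (6 ^ n * volume (ball x s))) := by ring
        _ ≤ 4 * (M * A * (6 ^ n * volume (ball x s))) := by gcongr; norm_num
        _ = lam * volume (ball x s) := by rw [hlam]; ring
    exact absurd h1 (not_lt.2 h3)
  -- A radius above sup/6 is nearly maximal: the mean exceeds `lam` at s, as the covering needs, but
  -- no longer at 6s, which controls the enlarged ball.
  have hex : ∀ x ∈ S, ∃ s ∈ T x, 6 * s ∉ T x := by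
    intro x ⟨hx, hne⟩
    have hbdd : BddAbove (T x) := ⟨R, fun s hs => hs.2.1.le⟩
    obtain ⟨s₀, hs₀⟩ := hne
    have hpos : 0 < sSup (T x) := hs₀.1.trans_le (le_csSup hbdd hs₀)
    obtain ⟨s, hs, hlt⟩ := exists_lt_of_lt_csSup ⟨s₀, hs₀⟩ (by linarith : sSup (T x) / 6 < sSup (T x))
    refine ⟨s, hs, fun h6 => ?_⟩
    have := le_csSup hbdd h6
    linarith
  choose! s hsT hs6 using hex
  obtain ⟨u, huS, huc, hcov, hsum⟩ := exists_countable_cover_of_mean_ge (g := g) (S := S)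
    (U := ball x₀ (2 * R)) (s := s) (R := R) (lam := lam) fun x hx =>
      ⟨(hsT x hx).1, (hsT x hx).2.1.le, hsub x hx.1 _ (hsT x hx).2.1.le, (hsT x hx).2.2.le⟩
  refine ⟨u, fun x => 6 * s x, huc, fun x hx => ⟨?_, ?_⟩, ?_, ?_⟩
  · linarith [(hsT x (huS hx)).1]
  · have hn := hs6 x (huS hx)
    have hp := (hsT x (huS hx)).1
    simp only [hT, Set.mem_ofPred_eq, not_and, not_lt] at hn
    exact hn (by linarith) (hsmall x (huS hx).1 _ (hsT x (huS hx)))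
  · have hMA0 : (6 : ℝ≥0∞) ^ n * M * A ≠ 0 := by
      refine mul_ne_zero (mul_ne_zero (by positivity) hM0) hA0
    have hMAt : (6 : ℝ≥0∞) ^ n * M * A ≠ ∞ := by finiteness
    rw [← ENNReal.mul_le_mul_iff_right hMA0 hMAt]
    calc 6 ^ n * M * A * (4 * ∑' x : u, volume (ball (x : Rn n) (6 * s x)))
        = lam * ∑' x : u, volume (ball (x : Rn n) (6 * s x)) := by rw [hlam]; ring
      _ ≤ 6 ^ n * (M * A * volume (ball x₀ R)) := hsum.trans (by gcongr)
      _ = _ := by ring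
  · filter_upwards [ae_le_of_lintegral_ball_le (lam := lam) hgm hintfin] with y hy hyB hyu
    refine hy hyB fun t ht0 htR => ?_
    by_contra! hcon
    exact hyu (hcov ⟨hyB, t, ht0, htR, hcon⟩)

/-- A self-improvement argument: the supremum X over all balls of the mean of the truncated square
is finite because of the truncation, and one Calderón–Zygmund step gives X ≤ K A² + X/2. Absorbing
X/2 leaves a bound independent of N, without passing through exponential decay. -/
lemma lintegral_min_sq_le {n : ℕ} {F : Type*} [NormedAddCommGroup F] {b : Rn n → F}
    (hb : AEStronglyMeasurable b) {c : Rn n → ℝ → F} {A : ℝ≥0∞} (hA0 : A ≠ 0) (hA : A ≠ ∞)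
    (h : ∀ x r, 0 < r → ∫⁻ y in ball x r, ‖b y - c x r‖ₑ ≤ A * volume (ball x r))
    (N : ℕ) (x₀ : Rn n) {R : ℝ} (hR : 0 < R) :
    ∫⁻ y in ball x₀ R, min ‖b y - c x₀ R‖ₑ N ^ 2 ≤
      4 * (1 + 4 * 6 ^ n * (2 ^ n * (2 + 2 ^ n))) ^ 2 * A ^ 2 * volume (ball x₀ R) := by
  set L : ℝ≥0∞ := 4 * 6 ^ n * (2 ^ n * (2 + 2 ^ n)) with hL
  set f : Rn n → ℝ → Rn n → ℝ≥0∞ := fun x r y => min ‖b y - c x r‖ₑ N ^ 2 with hf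
  set X : ℝ≥0∞ := ⨆ (x : Rn n) (r : ℝ) (_ : 0 < r),
    (∫⁻ y in ball x r, f x r y) / volume (ball x r) with hX
  have hXN : X ≤ (N : ℝ≥0∞) ^ 2 := by
    refine iSup_le fun x => iSup_le fun r => iSup_le fun hr => ENNReal.div_le_of_le_mul ?_
    rw [← setLIntegral_const]
    refine lintegral_mono fun y => ?_
    simp only [hf]
    gcongr
    exact min_le_right _ _
  have hXtop : X ≠ ∞ := ne_top_of_le_ne_top (by finiteness) hXN
  have hXball : ∀ x r, 0 < r → ∫⁻ y in ball x r, f x r y ≤ X * volume (ball x r) := by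
    intro x r hr
    rw [← ENNReal.div_le_iff (volume_ball_ne_zero x hr) (volume_ball_ne_top x r)]
    exact le_iSup_of_le x (le_iSup_of_le r (le_iSup_of_le hr le_rfl))
  have key : ∀ x r, 0 < r → ∫⁻ y in ball x r, f x r y ≤
      ((2 * (1 + L) ^ 2 * A ^ 2) + X / 2) * volume (ball x r) := by
    intro x r hr
    obtain ⟨u, s, huc, hu, hsum, hae⟩ := exists_calderon_zygmund_cover hb hA0 hA h x hr
    have := huc.to_subtype
    set W : Set (Rn n) := ⋃ z ∈ u, ball z (s z) with hW
    -- On a bad ball, c x r is replaced by the ball's own constant; the two differ by at most (1 +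
    -- L)A because b has bounded mean distance to both there.
    have hpart : ∀ z ∈ u, ∫⁻ y in ball z (s z), f x r y ≤
        (2 * X + 2 * ((1 + L) * A) ^ 2) * volume (ball z (s z)) := by
      intro z hz
      obtain ⟨hs, hmean⟩ := hu z hz
      have hc : ‖c z (s z) - c x r‖ₑ ≤ (1 + L) * A := by
        rw [← ENNReal.mul_le_mul_iff_left (volume_ball_ne_zero z hs) (volume_ball_ne_top z _)]
        calc _ ≤ _ := enorm_sub_mul_volume_le hb _ _ _
          _ ≤ A * volume (ball z (s z)) + L * A * volume (ball z (s z)) :=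
              add_le_add (h z _ hs) hmean
          _ = _ := by ring
      calc ∫⁻ y in ball z (s z), f x r y
          ≤ ∫⁻ y in ball z (s z), (2 * f z (s z) y + 2 * ((1 + L) * A) ^ 2) := by
            refine lintegral_mono fun y => ?_
            simp only [hf]
            refine le_trans ?_ (ennreal_add_sq_le _ _)
            gcongr
            refine le_trans ?_ (min_add_le_min_add _ _ _)
            gcongr
            refine le_trans ?_ (add_le_add_right hc _)
            have : b y - c x r = (b y - c z (s z)) + (c z (s z) - c x r) := by abel
            rw [this]
            exact enorm_add_le _ _
        _ = 2 * (∫⁻ y in ball z (s z), f z (s z) y) +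
              2 * ((1 + L) * A) ^ 2 * volume (ball z (s z)) := by
            rw [lintegral_add_right _ measurable_const, setLIntegral_const,
              lintegral_const_mul' _ _ (by norm_num)]
        _ ≤ 2 * (X * volume (ball z (s z))) + 2 * ((1 + L) * A) ^ 2 * volume (ball z (s z)) := by
            gcongr
            exact hXball z _ hs
        _ = _ := by ring
    have hgood : ∫⁻ y in ball x r \ W, f x r y ≤ (L * A) ^ 2 * volume (ball x r) := by
      have hmeas : MeasurableSet (ball x r \ W) :=
        measurableSet_ball.diff (MeasurableSet.biUnion huc fun z _ => measurableSet_ball)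
      calc ∫⁻ y in ball x r \ W, f x r y ≤ ∫⁻ y in ball x r \ W, (L * A) ^ 2 := by
            refine setLIntegral_mono_ae' hmeas ?_
            filter_upwards [hae] with y hy hyW
            simp only [hf]
            gcongr
            exact (min_le_left _ _).trans (hy hyW.1 hyW.2)
        _ ≤ _ := by
            rw [setLIntegral_const]
            gcongr
            exact Set.sdiff_subset
    have hbad : ∫⁻ y in W, f x r y ≤
        (2 * X + 2 * ((1 + L) * A) ^ 2) * ∑' z : u, volume (ball (z : Rn n) (s z)) := by
      rw [hW, Set.biUnion_eq_iUnion, ← ENNReal.tsum_mul_left]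
      refine (lintegral_iUnion_le _ _).trans (ENNReal.tsum_le_tsum fun z => hpart z z.2)
    -- The bad balls have a quarter of the volume, so their contribution 2X becomes X/2 and can be
    -- absorbed.
    have h4 : ∑' z : u, volume (ball (z : Rn n) (s z)) ≤ 4⁻¹ * volume (ball x r) := by
      rw [← ENNReal.mul_le_mul_iff_right (a := 4) (by norm_num) (by norm_num), ← mul_assoc,
        ENNReal.mul_inv_cancel (by norm_num) (by norm_num), one_mul]
      exact hsum
    have h24 : (2 : ℝ≥0∞) * 4⁻¹ = 2⁻¹ := by
      rw [show (4 : ℝ≥0∞) = 2 * 2 by norm_num, ENNReal.mul_inv (by simp) (by simp), ← mul_assoc,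
        ENNReal.mul_inv_cancel (by norm_num) (by norm_num), one_mul]
    calc ∫⁻ y in ball x r, f x r y ≤ ∫⁻ y in (ball x r \ W) ∪ W, f x r y :=
          lintegral_mono_set (by intro y hy; by_cases hyW : y ∈ W <;> simp [hy, hyW])
      _ ≤ (L * A) ^ 2 * volume (ball x r) +
            (2 * X + 2 * ((1 + L) * A) ^ 2) * (4⁻¹ * volume (ball x r)) := by
          refine (lintegral_union_le _ _ _).trans (add_le_add hgood (hbad.trans ?_))
          gcongr
      _ = ((L * A) ^ 2 + 2 * 4⁻¹ * ((1 + L) * A) ^ 2 + (2 * 4⁻¹) * X) * volume (ball x r) := by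
          ring
      _ ≤ (((1 + L) * A) ^ 2 + 1 * ((1 + L) * A) ^ 2 + (2 * 4⁻¹) * X) * volume (ball x r) := by
          gcongr
          · exact le_add_self
          · rw [h24]; norm_num
      _ = _ := by rw [h24, ENNReal.div_eq_inv_mul]; ring
  have hXle : X ≤ 2 * (1 + L) ^ 2 * A ^ 2 + X / 2 :=
    iSup_le fun x => iSup_le fun r => iSup_le fun hr => ENNReal.div_le_of_le_mul (key x r hr)
  have hXfin : X ≤ 4 * (1 + L) ^ 2 * A ^ 2 := by
    have h2 : X / 2 ≤ 2 * (1 + L) ^ 2 * A ^ 2 := by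
      have hne : X / 2 ≠ ∞ := by finiteness
      rw [← ENNReal.add_le_add_iff_right hne, ENNReal.add_halves]
      exact hXle
    calc X = 2 * (X / 2) := by rw [ENNReal.mul_div_cancel (by norm_num) (by norm_num)]
      _ ≤ 2 * (2 * (1 + L) ^ 2 * A ^ 2) := by gcongr
      _ = _ := by ring
  exact (hXball x₀ R hR).trans (by gcongr)

/-- The square of the constant in the `L²` John–Nirenberg inequality. -/
noncomputable def jnConst (n : ℕ) : ℝ≥0∞ := 4 * (1 + 4 * 6 ^ n * (2 ^ n * (2 + 2 ^ n))) ^ 2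

lemma jnConst_ne_top (n : ℕ) : jnConst n ≠ ∞ := by unfold jnConst; finiteness

open Filter Topology in
lemma lintegral_sq_le_of_forall_min {α : Type*} [MeasurableSpace α] {μ : Measure α} {g : α → ℝ≥0∞}
    (hg : AEMeasurable g μ) {K : ℝ≥0∞} (h : ∀ N : ℕ, ∫⁻ y, min (g y) N ^ 2 ∂μ ≤ K) :
    ∫⁻ y, g y ^ 2 ∂μ ≤ K := by
  have hlim : ∀ y, Tendsto (fun N : ℕ => min (g y) N ^ 2) atTop (𝓝 (g y ^ 2)) := by
    intro y
    have := (tendsto_const_nhds (x := g y)).min ENNReal.tendsto_nat_nhds_top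
    rw [min_eq_left le_top] at this
    exact ENNReal.Tendsto.pow this
  calc ∫⁻ y, g y ^ 2 ∂μ = ∫⁻ y, liminf (fun N : ℕ => min (g y) N ^ 2) atTop ∂μ :=
        lintegral_congr fun y => (hlim y).liminf_eq.symm
    _ ≤ liminf (fun N : ℕ => ∫⁻ y, min (g y) N ^ 2 ∂μ) atTop :=
        lintegral_liminf_le' fun N => (hg.min aemeasurable_const).pow_const 2
    _ ≤ liminf (fun _ : ℕ => K) atTop := liminf_le_liminf (Eventually.of_forall h)
    _ = K := by simp

/-- The `L²` form of the **John–Nirenberg inequality**. -/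
theorem lintegral_sq_le_of_lintegral_le {n : ℕ} {F : Type*} [NormedAddCommGroup F] {b : Rn n → F}
    (hb : AEStronglyMeasurable b) {c : Rn n → ℝ → F} {A : ℝ≥0∞} (hA : A ≠ ∞)
    (h : ∀ x r, 0 < r → ∫⁻ y in ball x r, ‖b y - c x r‖ₑ ≤ A * volume (ball x r))
    (x₀ : Rn n) {R : ℝ} (hR : 0 < R) :
    ∫⁻ y in ball x₀ R, ‖b y - c x₀ R‖ₑ ^ 2 ≤ jnConst n * A ^ 2 * volume (ball x₀ R) := by
  have hm : AEMeasurable (fun y => ‖b y - c x₀ R‖ₑ) (volume.restrict (ball x₀ R)) :=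
    (hb.restrict.sub aestronglyMeasurable_const).enorm
  -- The stopping height is a multiple of A, so A = 0 has to be treated apart; then b is constant
  -- a.e. on the ball.
  rcases eq_or_ne A 0 with rfl | hA0
  · have h0 := h x₀ R hR
    rw [zero_mul, nonpos_iff_eq_zero, lintegral_eq_zero_iff' hm] at h0
    rw [lintegral_congr_ae (g := fun _ => 0) (by filter_upwards [h0] with y hy; simp_all)]
    simp
  exact lintegral_sq_le_of_forall_min hm fun N => lintegral_min_sq_le hb hA0 hA h N x₀ hR

/-! ### The grand maximal function: measurability and the L² bound -/

lemma grandMax_congr_ae {𝕜 : Type*} [RCLike 𝕜] {n : ℕ} {f g : Rn n → 𝕜} (h : f =ᵐ[volume] g)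
    (x : Rn n) : grandMax f x = grandMax g x := by
  have hint : ∀ φ : Rn n → 𝕜, ∫ y, f y * φ y = ∫ y, g y * φ y := fun φ =>
    integral_congr_ae (by filter_upwards [h] with y hy; rw [hy])
  simp only [grandMax, hint]

lemma IsTestFun.eq_zero {𝕜 : Type*} [RCLike 𝕜] {n : ℕ} {x y : Rn n} {t : ℝ} {φ : Rn n → 𝕜}
    (h : IsTestFun x t φ) (hy : y ∉ ball x t) : φ y = 0 :=
  image_eq_zero_of_notMem_tsupport fun hy' => hy (h.2.1 hy')

lemma IsTestFun.enorm_le {𝕜 : Type*} [RCLike 𝕜] {n : ℕ} {x : Rn n} {t : ℝ} {φ : Rn n → 𝕜}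
    (h : IsTestFun x t φ) (ht : 0 < t) (y : Rn n) : ‖φ y‖ₑ ≤ (volume (ball x t))⁻¹ := by
  rw [← ofReal_norm]
  refine (ENNReal.ofReal_le_ofReal (h.2.2.1 y)).trans ?_
  have hv : 0 < volume.real (ball x t) :=
    ENNReal.toReal_pos (volume_ball_ne_zero x ht) (volume_ball_ne_top x t)
  rw [ENNReal.ofReal_inv_of_pos hv, Measure.real, ENNReal.ofReal_toReal (volume_ball_ne_top x t)]

/-- The dependence of test functions on the centre is locally constant. -/
lemma IsTestFun.eventually {𝕜 : Type*} [RCLike 𝕜] {n : ℕ} {x : Rn n} {t : ℝ} {φ : Rn n → 𝕜}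
    (h : IsTestFun x t φ) : ∀ᶠ x' in nhds x, IsTestFun x' t φ := by
  obtain ⟨h1, h2, h3, h4⟩ := h
  have hcomp : IsCompact (tsupport φ) :=
    (isCompact_closedBall x t).of_isClosed_subset (isClosed_tsupport φ)
      (h2.trans ball_subset_closedBall)
  -- The closed support is compact in the open ball, so it lies in a smaller concentric ball; the
  -- slack t - s is the room for moving the centre.
  obtain ⟨s, hst, hs⟩ : ∃ s < t, tsupport φ ⊆ ball x s := by
    rcases (tsupport φ).eq_empty_or_nonempty with he | hne
    · exact ⟨t - 1, by linarith, by simp [he]⟩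
    · obtain ⟨z, hz, hmax⟩ := hcomp.exists_isMaxOn hne
        (f := fun y => dist y x) (by fun_prop)
      have hzt : dist z x < t := h2 hz
      refine ⟨(dist z x + t) / 2, by linarith, fun y hy => ?_⟩
      have : dist y x ≤ dist z x := hmax hy
      rw [mem_ball]; linarith
  filter_upwards [ball_mem_nhds x (sub_pos.2 hst)] with x' hx'
  have hv : volume.real (ball x' t) = volume.real (ball x t) := by
    rw [Measure.real, Measure.real, volume_ball_eq x' x]
  refine ⟨h1, hs.trans (ball_subset_ball' ?_), by rwa [hv], by rwa [hv]⟩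
  have := mem_ball.1 hx'
  rw [dist_comm] at this; linarith

lemma lowerSemicontinuous_grandMax {𝕜 : Type*} [RCLike 𝕜] {n : ℕ} (f : Rn n → 𝕜) :
    LowerSemicontinuous (grandMax f) := by
  intro x y hy
  simp only [grandMax, lt_iSup_iff] at hy
  obtain ⟨t, ht, φ, hφ, hlt⟩ := hy
  filter_upwards [hφ.eventually] with x' hx'
  refine hlt.trans_le ?_
  exact le_iSup_of_le t (le_iSup_of_le ht (le_iSup_of_le φ (le_iSup_of_le hx' le_rfl)))

lemma measurable_grandMax {𝕜 : Type*} [RCLike 𝕜] {n : ℕ} (f : Rn n → 𝕜) :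
    Measurable (grandMax f) := (lowerSemicontinuous_grandMax f).measurable

/-- The grand maximal function is controlled by the local Hardy–Littlewood maximal function. -/
lemma exists_lt_lintegral_of_lt_grandMax {𝕜 : Type*} [RCLike 𝕜] {n : ℕ} {f : Rn n → 𝕜} {x : Rn n}
    {lam : ℝ≥0∞} (h : lam < grandMax f x) :
    ∃ t, 0 < t ∧ t < 1 ∧ lam * volume (ball x t) < ∫⁻ y in ball x t, ‖f y‖ₑ := by
  simp only [grandMax, lt_iSup_iff] at h
  obtain ⟨t, ⟨ht0, ht1⟩, φ, hφ, hlt⟩ := h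
  refine ⟨t, ht0, ht1, ?_⟩
  rw [← ENNReal.lt_div_iff_mul_lt (Or.inl (volume_ball_ne_zero x ht0))
    (Or.inl (volume_ball_ne_top x t))]
  calc lam < ‖∫ y, f y * φ y‖ₑ := hlt
    _ ≤ ∫⁻ y, ‖f y * φ y‖ₑ := enorm_integral_le_lintegral_enorm _
    _ = ∫⁻ y in ball x t, ‖f y * φ y‖ₑ := by
        rw [← lintegral_indicator measurableSet_ball]
        refine lintegral_congr fun y => ?_
        by_cases hy : y ∈ ball x t
        · rw [Set.indicator_of_mem hy]
        · rw [Set.indicator_of_notMem hy, hφ.eq_zero hy]; simp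
    _ ≤ ∫⁻ y in ball x t, ‖f y‖ₑ * (volume (ball x t))⁻¹ := by
        refine lintegral_mono fun y => ?_
        simp only [enorm_mul]
        gcongr
        exact hφ.enorm_le ht0 y
    _ = _ := by
        rw [lintegral_mul_const' _ _ (ENNReal.inv_ne_top.2 (volume_ball_ne_zero x ht0)),
          ENNReal.div_eq_inv_mul, mul_comm]

/-- Weak type `(1, 1)` estimate for the grand maximal function, restricted to large values. -/
lemma mul_volume_lt_grandMax_le {𝕜 : Type*} [RCLike 𝕜] {n : ℕ} {f : Rn n → 𝕜} {lam : ℝ≥0∞}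
    (hlam : lam ≠ ∞) :
    lam * volume {x | 2 * lam < grandMax f x} ≤
      6 ^ n * ∫⁻ y, {y | lam < ‖f y‖ₑ}.indicator (fun y => ‖f y‖ₑ) y := by
  -- Only the part of |f| above `lam` matters: |f| ≤ `lam` + g, so a mean of |f| above 2`lam` forces
  -- a mean of g above `lam`.
  set g : Rn n → ℝ≥0∞ := {y | lam < ‖f y‖ₑ}.indicator (fun y => ‖f y‖ₑ) with hg
  have hfg : ∀ y, ‖f y‖ₑ ≤ lam + g y := by
    intro y
    by_cases hy : lam < ‖f y‖ₑ
    · rw [hg, Set.indicator_of_mem (by exact hy)]; exact le_add_self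
    · exact (not_lt.1 hy).trans le_self_add
  have hex : ∀ x ∈ {x | 2 * lam < grandMax f x}, ∃ t, 0 < t ∧ t ≤ 1 ∧ ball x t ⊆ Set.univ ∧
      lam * volume (ball x t) ≤ ∫⁻ y in ball x t, g y := by
    intro x hx
    obtain ⟨t, ht0, ht1, ht⟩ := exists_lt_lintegral_of_lt_grandMax hx
    refine ⟨t, ht0, ht1.le, Set.subset_univ _, ?_⟩
    have hne : lam * volume (ball x t) ≠ ∞ := ENNReal.mul_ne_top hlam (volume_ball_ne_top x t)
    rw [← ENNReal.add_le_add_iff_left hne]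
    calc lam * volume (ball x t) + lam * volume (ball x t) = 2 * lam * volume (ball x t) := by ring
      _ ≤ ∫⁻ y in ball x t, ‖f y‖ₑ := ht.le
      _ ≤ ∫⁻ y in ball x t, (lam + g y) := lintegral_mono hfg
      _ = _ := by rw [lintegral_add_left measurable_const, setLIntegral_const]
  choose! s hs using hex
  obtain ⟨u, huS, huc, hcov, hsum⟩ := exists_countable_cover_of_mean_ge hs
  have := huc.to_subtype
  rw [Measure.restrict_univ] at hsum
  refine le_trans ?_ hsum
  gcongr
  refine (measure_mono hcov).trans ?_
  rw [Set.biUnion_eq_iUnion]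
  exact measure_iUnion_le _

/-- Marcinkiewicz interpolation: the layer cake formula is combined at level t with the weak type
estimate for the part of f above t/2. Truncation at N keeps the level function real-valued, and
strong measurability of f gives the joint measurability that Tonelli requires. -/
lemma lintegral_grandMax_sq_le_of_stronglyMeasurable {𝕜 : Type*} [RCLike 𝕜] {n : ℕ}
    {f : Rn n → 𝕜} (hf : StronglyMeasurable f) :
    ∫⁻ x, grandMax f x ^ 2 ≤ 8 * 6 ^ n * ∫⁻ y, ‖f y‖ₑ ^ 2 := by
  refine lintegral_sq_le_of_forall_min (measurable_grandMax f).aemeasurable fun N => ?_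
  set F : Rn n → ℝ := fun x => (min (grandMax f x) N).toReal with hF
  have hFtop : ∀ x, min (grandMax f x) N ≠ ∞ := fun x =>
    ne_top_of_le_ne_top (ENNReal.natCast_ne_top N) (min_le_right _ _)
  have hFm : Measurable F := ((measurable_grandMax f).min measurable_const).ennreal_toReal
  have hlevel : ∀ t : ℝ, 0 < t → volume {x | t < F x} * ENNReal.ofReal t ≤
      2 * 6 ^ n * ∫⁻ y, {y | t < 2 * ‖f y‖}.indicator (fun y => ‖f y‖ₑ) y := by
    intro t ht
    have h2 : 2 * ENNReal.ofReal (t / 2) = ENNReal.ofReal t := by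
      rw [← ENNReal.ofReal_ofNat, ← ENNReal.ofReal_mul (by norm_num)]; congr 1; ring
    have hsub : {x | t < F x} ⊆ {x | 2 * ENNReal.ofReal (t / 2) < grandMax f x} := by
      intro x hx
      have h1 : ENNReal.ofReal t < min (grandMax f x) N := (ENNReal.ofReal_lt_iff_lt_toReal ht.le (hFtop x)).2 hx
      show 2 * ENNReal.ofReal (t / 2) < grandMax f x
      rw [h2]
      exact h1.trans_le (min_le_left _ _)
    have hset : {y | ENNReal.ofReal (t / 2) < ‖f y‖ₑ} = {y | t < 2 * ‖f y‖} := by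
      ext y
      show ENNReal.ofReal (t / 2) < ‖f y‖ₑ ↔ t < 2 * ‖f y‖
      rw [← ofReal_norm, ENNReal.ofReal_lt_ofReal_iff_of_nonneg (by linarith)]
      constructor <;> intro h <;> linarith
    have hw := mul_volume_lt_grandMax_le (f := f) (lam := ENNReal.ofReal (t / 2)) ENNReal.ofReal_ne_top
    rw [hset] at hw
    calc volume {x | t < F x} * ENNReal.ofReal t
        = 2 * (ENNReal.ofReal (t / 2) * volume {x | t < F x}) := by
          rw [← mul_assoc, h2, mul_comm]
      _ ≤ 2 * (ENNReal.ofReal (t / 2) *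
            volume {x | 2 * ENNReal.ofReal (t / 2) < grandMax f x}) := by gcongr
      _ ≤ 2 * (6 ^ n * _) := by gcongr
      _ = _ := by ring
  have hmeas : Measurable (Function.uncurry fun (t : ℝ) (y : Rn n) =>
      {y | t < 2 * ‖f y‖}.indicator (fun y => ‖f y‖ₑ) y) := by
    have hs : MeasurableSet {p : ℝ × Rn n | p.1 < 2 * ‖f p.2‖} :=
      measurableSet_lt measurable_fst
        (measurable_const.mul (hf.norm.measurable.comp measurable_snd))
    exact (hf.enorm.comp measurable_snd).indicator hs
  calc ∫⁻ x, min (grandMax f x) N ^ 2 = ∫⁻ x, ENNReal.ofReal (F x ^ (2 : ℝ)) := by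
        refine lintegral_congr fun x => ?_
        rw [Real.rpow_two, ENNReal.ofReal_pow ENNReal.toReal_nonneg, ENNReal.ofReal_toReal (hFtop x)]
    _ = ENNReal.ofReal 2 * ∫⁻ t in Set.Ioi (0 : ℝ),
          volume {x | t < F x} * ENNReal.ofReal (t ^ ((2 : ℝ) - 1)) :=
        lintegral_rpow_eq_lintegral_meas_lt_mul volume
          (Filter.Eventually.of_forall fun x => ENNReal.toReal_nonneg) hFm.aemeasurable (by norm_num)
    _ ≤ 2 * ∫⁻ t in Set.Ioi (0 : ℝ),
          2 * 6 ^ n * ∫⁻ y, {y | t < 2 * ‖f y‖}.indicator (fun y => ‖f y‖ₑ) y := by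
        rw [ENNReal.ofReal_ofNat]
        gcongr 2 * ?_
        refine setLIntegral_mono' measurableSet_Ioi fun t ht => ?_
        have := hlevel t ht
        norm_num
        exact this
    _ = 4 * 6 ^ n * ∫⁻ t in Set.Ioi (0 : ℝ),
          ∫⁻ y, {y | t < 2 * ‖f y‖}.indicator (fun y => ‖f y‖ₑ) y := by
        rw [lintegral_const_mul' _ _ (by finiteness)]; ring
    _ = 4 * 6 ^ n * ∫⁻ y, ∫⁻ t in Set.Ioi (0 : ℝ),
          {y | t < 2 * ‖f y‖}.indicator (fun y => ‖f y‖ₑ) y := by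
        rw [lintegral_lintegral_swap hmeas.aemeasurable]
    _ = 4 * 6 ^ n * ∫⁻ y, 2 * ‖f y‖ₑ ^ 2 := by
        congr 1
        refine lintegral_congr fun y => ?_
        have : ∀ t : ℝ, {y | t < 2 * ‖f y‖}.indicator (fun y => ‖f y‖ₑ) y =
            (Set.Iio (2 * ‖f y‖)).indicator (fun _ => ‖f y‖ₑ) t := fun t => by
          simp [Set.indicator_apply]
        simp_rw [this]
        rw [lintegral_indicator measurableSet_Iio, Measure.restrict_restrict measurableSet_Iio,
          setLIntegral_const, Set.inter_comm, Set.Ioi_inter_Iio, Real.volume_Ioo, sub_zero,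
          ENNReal.ofReal_mul (by norm_num), ofReal_norm, ENNReal.ofReal_ofNat]
        ring
    _ = _ := by rw [lintegral_const_mul' _ _ (by norm_num)]; ring

/-- The grand maximal function is bounded on `L²`. -/
theorem lintegral_grandMax_sq_le {𝕜 : Type*} [RCLike 𝕜] {n : ℕ} {f : Rn n → 𝕜}
    (hf : AEStronglyMeasurable f) :
    ∫⁻ x, grandMax f x ^ 2 ≤ 8 * 6 ^ n * ∫⁻ y, ‖f y‖ₑ ^ 2 := by
  have h := lintegral_grandMax_sq_le_of_stronglyMeasurable hf.stronglyMeasurable_mk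
  simp_rw [← grandMax_congr_ae hf.ae_eq_mk] at h
  refine h.trans_eq ?_
  congr 1
  exact lintegral_congr_ae (by filter_upwards [hf.ae_eq_mk] with y hy; rw [hy])

/-! ### L² estimates for atoms and growth of bmo constants -/

lemma lintegral_mul_sq_le {α : Type*} [MeasurableSpace α] {μ : Measure α} {f g : α → ℝ≥0∞}
    (hf : AEMeasurable f μ) (hg : AEMeasurable g μ) :
    (∫⁻ x, f x * g x ∂μ) ^ 2 ≤ (∫⁻ x, f x ^ 2 ∂μ) * ∫⁻ x, g x ^ 2 ∂μ := by
  have h := ENNReal.lintegral_mul_le_Lp_mul_Lq μ Real.HolderConjugate.two_two hf hg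
  simp only [Pi.mul_apply, ENNReal.rpow_two] at h
  have hsq : ∀ u : ℝ≥0∞, (u ^ (1 / 2 : ℝ)) ^ 2 = u := fun u => by
    rw [← ENNReal.rpow_two, ← ENNReal.rpow_mul]; norm_num
  calc _ ≤ ((∫⁻ x, f x ^ 2 ∂μ) ^ (1 / 2 : ℝ) * (∫⁻ x, g x ^ 2 ∂μ) ^ (1 / 2 : ℝ)) ^ 2 := by gcongr
    _ = _ := by rw [mul_pow, hsq, hsq]

lemma IsAtom.lintegral_sq_le {𝕜 : Type*} [RCLike 𝕜] {n : ℕ} {a : Rn n → 𝕜} {x₀ : Rn n} {r : ℝ}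
    (ha : IsAtom a x₀ r) : ∫⁻ y, ‖a y‖ₑ ^ 2 ≤ (volume (ball x₀ r))⁻¹ := by
  have h := ha.size
  rw [eLpNorm_eq_lintegral_rpow_enorm_toReal (by norm_num) (by norm_num)] at h
  have h2 : ((∫⁻ y, ‖a y‖ₑ ^ (2 : ℝ)) ^ (1 / 2 : ℝ)) ^ (2 : ℝ) ≤
      (volume (ball x₀ r) ^ (-(1 / 2) : ℝ)) ^ (2 : ℝ) := by
    gcongr
    simpa using h
  rw [← ENNReal.rpow_mul, ← ENNReal.rpow_mul] at h2
  norm_num at h2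
  rwa [ENNReal.rpow_neg_one] at h2

lemma IsAtom.lintegral_eq_setLIntegral {𝕜 : Type*} [RCLike 𝕜] {n : ℕ} {a : Rn n → 𝕜} {x₀ : Rn n} {r : ℝ}
    (ha : IsAtom a x₀ r) (F : 𝕜 → Rn n → ℝ≥0∞) (hF : ∀ y, F 0 y = 0) :
    ∫⁻ y, F (a y) y = ∫⁻ y in ball x₀ r, F (a y) y := by
  rw [← lintegral_indicator measurableSet_ball]
  refine lintegral_congr_ae ?_
  filter_upwards [ha.support] with y hy
  by_cases h : y ∈ ball x₀ r
  · rw [Set.indicator_of_mem h]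
  · rw [Set.indicator_of_notMem h, hy h, hF]

lemma IsAtom.lintegral_mul_sq_le {𝕜 : Type*} [RCLike 𝕜] {n : ℕ} {a : Rn n → 𝕜} {x₀ : Rn n} {r : ℝ}
    (ha : IsAtom a x₀ r) {g : Rn n → ℝ≥0∞} (hg : AEMeasurable g) :
    (∫⁻ y, ‖a y‖ₑ * g y) ^ 2 ≤ (volume (ball x₀ r))⁻¹ * ∫⁻ y in ball x₀ r, g y ^ 2 := by
  rw [ha.lintegral_eq_setLIntegral (fun z y => ‖z‖ₑ * g y) (by simp)]
  refine (LocalHardy.lintegral_mul_sq_le ha.aestronglyMeasurable.enorm.restrict hg.restrict).trans ?_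
  gcongr
  exact (setLIntegral_le_lintegral _ _).trans ha.lintegral_sq_le

lemma IsAtom.lintegral_enorm_le_one {𝕜 : Type*} [RCLike 𝕜] {n : ℕ} {a : Rn n → 𝕜} {x₀ : Rn n}
    {r : ℝ} (ha : IsAtom a x₀ r) : ∫⁻ y, ‖a y‖ₑ ≤ 1 := by
  have h := ha.lintegral_mul_sq_le (g := fun _ => 1) aemeasurable_const
  simp only [mul_one, one_pow, setLIntegral_const, one_mul] at h
  rw [ENNReal.inv_mul_cancel (volume_ball_ne_zero x₀ ha.radius_pos) (volume_ball_ne_top x₀ r)] at h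
  exact (pow_le_one_iff (by norm_num)).1 h

lemma IsAtom.integrable {𝕜 : Type*} [RCLike 𝕜] {n : ℕ} {a : Rn n → 𝕜} {x₀ : Rn n}
    {r : ℝ} (ha : IsAtom a x₀ r) : Integrable a :=
  ⟨ha.aestronglyMeasurable, ha.lintegral_enorm_le_one.trans_lt (by norm_num)⟩

lemma setLIntegral_enorm_sub_bmoConst_le {𝕜 : Type*} [RCLike 𝕜] {n : ℕ} (b : Rn n → 𝕜)
    (x : Rn n) {r : ℝ} (hr : 0 < r) :
    ∫⁻ y in ball x r, ‖b y - bmoConst b x r‖ₑ ≤ bmoNorm b * volume (ball x r) := by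
  rw [← ENNReal.div_le_iff (volume_ball_ne_zero x hr) (volume_ball_ne_top x r), ← setLAverage_eq]
  exact le_iSup_of_le x (le_iSup_of_le r (le_iSup_of_le hr le_rfl))

lemma MemBmo.aestronglyMeasurable {𝕜 : Type*} [RCLike 𝕜] {n : ℕ} {b : Rn n → 𝕜} (hb : MemBmo b) :
    AEStronglyMeasurable b := hb.1.aestronglyMeasurable

lemma MemBmo.setLIntegral_sq_le {𝕜 : Type*} [RCLike 𝕜] {n : ℕ} {b : Rn n → 𝕜} (hb : MemBmo b)
    (x : Rn n) {r : ℝ} (hr : 0 < r) :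
    ∫⁻ y in ball x r, ‖b y - bmoConst b x r‖ₑ ^ 2 ≤
      jnConst n * bmoNorm b ^ 2 * volume (ball x r) :=
  lintegral_sq_le_of_lintegral_le hb.aestronglyMeasurable hb.2.ne
    (fun x _ hr => setLIntegral_enorm_sub_bmoConst_le b x hr) x hr

lemma volume_ball_two_pow_mul {n : ℕ} (x : Rn n) (k : ℕ) (r : ℝ) :
    volume (ball x (2 ^ k * r)) = (2 ^ k) ^ n * volume (ball x r) := by
  have := volume_ball_mul x x (k := 2 ^ k) (by positivity) r
  push_cast at this
  exact this

/-- Telescoping over doublings, each costing (1 + 2^n) times the norm. Crossing radius 1, where the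
constant becomes 0, needs no separate treatment: only the oscillation bounds on the two balls enter.
-/
lemma MemBmo.enorm_bmoConst_sub_le {𝕜 : Type*} [RCLike 𝕜] {n : ℕ} {b : Rn n → 𝕜} (hb : MemBmo b)
    (x : Rn n) {r : ℝ} (hr : 0 < r) (k : ℕ) :
    ‖bmoConst b x r - bmoConst b x (2 ^ k * r)‖ₑ ≤ k * ((1 + 2 ^ n) * bmoNorm b) := by
  induction k with
  | zero => simp
  | succ k ih =>
    have hk : 0 < 2 ^ k * r := by positivity
    have h2 : volume (ball x (2 * (2 ^ k * r))) = 2 ^ n * volume (ball x (2 ^ k * r)) := by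
      simpa using volume_ball_two_pow_mul x 1 (2 ^ k * r)
    have hstep := enorm_sub_le_of_ball_subset hb.aestronglyMeasurable
      (ball_subset_ball (by linarith : 2 ^ k * r ≤ 2 * (2 ^ k * r))) (volume_ball_ne_zero x hk)
      (volume_ball_ne_top x _) h2.le (setLIntegral_enorm_sub_bmoConst_le b x hk)
      (setLIntegral_enorm_sub_bmoConst_le b x (by positivity))
    rw [← mul_assoc, ← pow_succ'] at hstep
    calc _ = ‖(bmoConst b x r - bmoConst b x (2 ^ k * r)) +
          (bmoConst b x (2 ^ k * r) - bmoConst b x (2 ^ (k + 1) * r))‖ₑ := by congr 1; abel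
      _ ≤ k * ((1 + 2 ^ n) * bmoNorm b) + (1 + 2 ^ n) * bmoNorm b :=
          (enorm_add_le _ _).trans (add_le_add ih hstep)
      _ = _ := by push_cast; ring

lemma MemBmo.setLIntegral_enorm_sub_le {𝕜 : Type*} [RCLike 𝕜] {n : ℕ} {b : Rn n → 𝕜}
    (hb : MemBmo b) (x : Rn n) {r : ℝ} (hr : 0 < r) (k : ℕ) :
    ∫⁻ y in ball x (2 ^ k * r), ‖b y - bmoConst b x r‖ₑ ≤
      (1 + k * (1 + 2 ^ n)) * bmoNorm b * volume (ball x (2 ^ k * r)) := by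
  calc _ ≤ ∫⁻ y in ball x (2 ^ k * r), (‖b y - bmoConst b x (2 ^ k * r)‖ₑ +
          k * ((1 + 2 ^ n) * bmoNorm b)) := by
        refine lintegral_mono fun y => ?_
        refine le_trans ?_ (add_le_add_right (hb.enorm_bmoConst_sub_le x hr k) _)
        have : b y - bmoConst b x r = (b y - bmoConst b x (2 ^ k * r)) -
          (bmoConst b x r - bmoConst b x (2 ^ k * r)) := by abel
        rw [this]
        exact enorm_sub_le
    _ ≤ bmoNorm b * volume (ball x (2 ^ k * r)) +
          k * ((1 + 2 ^ n) * bmoNorm b) * volume (ball x (2 ^ k * r)) := by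
        rw [lintegral_add_right _ measurable_const, setLIntegral_const]
        gcongr
        exact setLIntegral_enorm_sub_bmoConst_le b x (by positivity)
    _ = _ := by ring

/-- The double ball is needed because the decay of the maximal function of an atom starts only
outside it. -/
lemma MemBmo.setLIntegral_two_mul_sq_le {𝕜 : Type*} [RCLike 𝕜] {n : ℕ} {b : Rn n → 𝕜}
    (hb : MemBmo b) (x : Rn n) {r : ℝ} (hr : 0 < r) :
    ∫⁻ y in ball x (2 * r), ‖b y - bmoConst b x r‖ₑ ^ 2 ≤
      2 ^ n * (2 * jnConst n + 2 * (1 + 2 ^ n) ^ 2) * bmoNorm b ^ 2 * volume (ball x r) := by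
  have h2 : volume (ball x (2 * r)) = 2 ^ n * volume (ball x r) := by
    simpa using volume_ball_two_pow_mul x 1 r
  have hc : ‖bmoConst b x r - bmoConst b x (2 * r)‖ₑ ≤ (1 + 2 ^ n) * bmoNorm b := by
    simpa using hb.enorm_bmoConst_sub_le x hr 1
  calc _ ≤ ∫⁻ y in ball x (2 * r), (2 * ‖b y - bmoConst b x (2 * r)‖ₑ ^ 2 +
          2 * ((1 + 2 ^ n) * bmoNorm b) ^ 2) := by
        refine lintegral_mono fun y => ?_
        refine le_trans ?_ (ennreal_add_sq_le _ _)
        gcongr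
        refine le_trans ?_ (add_le_add_right hc _)
        have : b y - bmoConst b x r = (b y - bmoConst b x (2 * r)) -
          (bmoConst b x r - bmoConst b x (2 * r)) := by abel
        rw [this]
        exact enorm_sub_le
    _ ≤ 2 * (jnConst n * bmoNorm b ^ 2 * volume (ball x (2 * r))) +
          2 * ((1 + 2 ^ n) * bmoNorm b) ^ 2 * volume (ball x (2 * r)) := by
        rw [lintegral_add_right _ measurable_const, setLIntegral_const,
          lintegral_const_mul' _ _ (by norm_num)]
        gcongr
        exact hb.setLIntegral_sq_le x (by positivity)
    _ = _ := by rw [h2]; ring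

/-! ### Decay away from the ball and the error term -/

/-- Decay of the grand maximal function of an atom away from its ball. -/
lemma IsAtom.grandMax_le {𝕜 : Type*} [RCLike 𝕜] {n : ℕ} {a : Rn n → 𝕜} {x₀ : Rn n} {r : ℝ}
    (ha : IsAtom a x₀ r) (h0 : r < 1 → ∫ y, a y = 0) (j : ℕ) {x : Rn n}
    (hx : x ∉ ball x₀ (2 ^ (j + 1) * r)) :
    grandMax a x ≤ (2 ^ j)⁻¹ * (volume (ball x₀ (2 ^ j * r)))⁻¹ := by
  refine iSup_le fun t => iSup_le fun ht => iSup_le fun φ => iSup_le fun hφ => ?_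
  have hr := ha.radius_pos
  rw [mem_ball, not_lt] at hx
  have h2j : (1 : ℝ) ≤ 2 ^ j := one_le_pow₀ (by norm_num)
  -- If t + r ≤ |x - x₀|, the test ball misses the support of a. Otherwise t > 2^(j+1) r - r ≥ 2^j
  -- r.
  by_cases htr : t + r ≤ dist x x₀
  · have : ∫ y, a y * φ y = 0 := by
      refine integral_eq_zero_of_ae ?_
      filter_upwards [ha.support] with y hy
      by_cases hyB : y ∈ ball x₀ r
      · have : y ∉ ball x t := fun hyt => by
          have h1 := mem_ball.1 hyB
          have h2 := mem_ball'.1 hyt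
          linarith [dist_triangle x y x₀]
        simp [hφ.eq_zero this]
      · simp [hy hyB]
    rw [this]; simp
  push Not at htr
  have ht2 : 2 ^ j * r ≤ t := by
    rw [pow_succ] at hx; nlinarith
  -- Scales are below 1, so this case forces r < 1 and cancellation is available. For r ≥ 1 only the
  -- disjoint case occurs.
  have hr1 : r < 1 := by nlinarith [ht.2]
  have hv : 0 < volume.real (ball x t) :=
    ENNReal.toReal_pos (volume_ball_ne_zero x ht.1) (volume_ball_ne_top x t)
  have hint : ∫ y, a y * φ y = ∫ y, a y * (φ y - φ x₀) := by
    have hφi : Integrable fun y => a y * φ y :=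
      ha.integrable.mul_bdd hφ.1.continuous.aestronglyMeasurable
        (Filter.Eventually.of_forall hφ.2.2.1)
    simp_rw [mul_sub]
    rw [integral_sub hφi (ha.integrable.mul_const _), integral_mul_const, h0 hr1]
    simp
  have hdiff : ∀ y ∈ ball x₀ r, ‖φ y - φ x₀‖ₑ ≤ ENNReal.ofReal (r * (t * volume.real (ball x t))⁻¹) := by
    intro y hy
    rw [← ofReal_norm]
    refine ENNReal.ofReal_le_ofReal ?_
    have := convex_univ.norm_image_sub_le_of_norm_fderiv_le (𝕜 := ℝ) (f := φ) (x := x₀) (y := y)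
      (fun z _ => hφ.1.differentiable (by norm_num) z) (fun z _ => hφ.2.2.2 z)
      (Set.mem_univ _) (Set.mem_univ _)
    refine this.trans ?_
    rw [mul_comm]
    have hd : ‖y - x₀‖ ≤ r := by rw [← dist_eq_norm]; exact (mem_ball.1 hy).le
    have := ht.1
    gcongr
  calc ‖∫ y, a y * φ y‖ₑ ≤ ∫⁻ y, ‖a y‖ₑ * ‖φ y - φ x₀‖ₑ := by
        rw [hint]
        refine (enorm_integral_le_lintegral_enorm _).trans_eq ?_
        simp
    _ = ∫⁻ y in ball x₀ r, ‖a y‖ₑ * ‖φ y - φ x₀‖ₑ :=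
        ha.lintegral_eq_setLIntegral (fun z y => ‖z‖ₑ * ‖φ y - φ x₀‖ₑ) (by simp)
    _ ≤ ∫⁻ y in ball x₀ r, ‖a y‖ₑ * ENNReal.ofReal (r * (t * volume.real (ball x t))⁻¹) :=
        setLIntegral_mono' measurableSet_ball fun y hy => by gcongr; exact hdiff y hy
    _ ≤ 1 * ENNReal.ofReal (r * (t * volume.real (ball x t))⁻¹) := by
        rw [lintegral_mul_const' _ _ ENNReal.ofReal_ne_top]
        gcongr
        exact (setLIntegral_le_lintegral _ _).trans ha.lintegral_enorm_le_one
    _ = ENNReal.ofReal (r / t) * (volume (ball x t))⁻¹ := by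
        rw [one_mul, mul_inv, ← mul_assoc, ← div_eq_mul_inv r t,
          ENNReal.ofReal_mul (div_nonneg hr.le ht.1.le), ENNReal.ofReal_inv_of_pos hv, Measure.real,
          ENNReal.ofReal_toReal (volume_ball_ne_top x t)]
    _ ≤ (2 ^ j)⁻¹ * (volume (ball x₀ (2 ^ j * r)))⁻¹ := by
        refine mul_le_mul' ?_ (ENNReal.inv_le_inv.2 ?_)
        · have : ((2 : ℝ≥0∞) ^ j)⁻¹ = ENNReal.ofReal ((2 ^ j)⁻¹) := by
            rw [ENNReal.ofReal_inv_of_pos (by positivity), ENNReal.ofReal_pow (by norm_num),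
              ENNReal.ofReal_ofNat]
          rw [this]
          refine ENNReal.ofReal_le_ofReal ?_
          rw [div_le_iff₀ ht.1, inv_mul_eq_div, le_div_iff₀ (by positivity)]
          linarith
        · rw [volume_ball_eq x₀ x]
          exact measure_mono (ball_subset_ball ht2)

lemma tsum_inv_two_pow_mul_ne_top (n : ℕ) :
    ∑' j : ℕ, ((2 : ℝ≥0∞) ^ j)⁻¹ * (4 ^ n * (1 + ((j + 2 : ℕ) : ℝ≥0∞) * (1 + 2 ^ n))) ≠ ∞ := by
  have hs : Summable fun j : ℕ => ((2 : ℝ) ^ j)⁻¹ * (4 ^ n * (1 + ((j + 2 : ℕ) : ℝ) * (1 + 2 ^ n))) := by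
    have h1 : Summable fun j : ℕ => (j : ℝ) ^ 1 * (1 / 2 : ℝ) ^ j :=
      summable_pow_mul_geometric_of_norm_lt_one 1 (by norm_num)
    have h0 : Summable fun j : ℕ => (1 / 2 : ℝ) ^ j :=
      summable_geometric_of_lt_one (by norm_num) (by norm_num)
    refine ((h0.mul_left (4 ^ n * (1 + 2 * (1 + 2 ^ n)))).add
      (h1.mul_left (4 ^ n * (1 + 2 ^ n)))).congr fun j => ?_
    rw [one_div, inv_pow]
    push_cast
    ring
  refine ne_of_eq_of_ne (tsum_congr fun j => ?_) hs.tsum_ofReal_ne_top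
  rw [ENNReal.ofReal_mul (by positivity), ENNReal.ofReal_inv_of_pos (by positivity),
    ENNReal.ofReal_pow (by norm_num), ENNReal.ofReal_mul (by positivity),
    ENNReal.ofReal_pow (by norm_num), ENNReal.ofReal_add (by norm_num) (by positivity),
    ENNReal.ofReal_mul (by positivity), ENNReal.ofReal_add (by norm_num) (by positivity),
    ENNReal.ofReal_pow (by norm_num), ENNReal.ofReal_natCast]
  simp

/-- The constant in `lintegral_enorm_sub_mul_grandMax_le`. -/
noncomputable def errorConst (n : ℕ) : ℝ≥0∞ :=
  (1 + 2 ^ n * (2 * jnConst n + 2 * (1 + 2 ^ n) ^ 2) * (8 * 6 ^ n)) +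
    ∑' j : ℕ, ((2 : ℝ≥0∞) ^ j)⁻¹ * (4 ^ n * (1 + ((j + 2 : ℕ) : ℝ≥0∞) * (1 + 2 ^ n)))

lemma errorConst_ne_top (n : ℕ) : errorConst n ≠ ∞ := by
  have := jnConst_ne_top n
  have := tsum_inv_two_pow_mul_ne_top n
  unfold errorConst
  finiteness

/-- Since √K ≤ 1 + K, square roots of constants can be avoided. -/
lemma ennreal_le_of_sq_le_mul_sq {u A K : ℝ≥0∞} (h : u ^ 2 ≤ K * A ^ 2) : u ≤ (1 + K) * A := by
  rw [← ENNReal.pow_le_pow_left_iff (n := 2) (by norm_num), mul_pow]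
  refine h.trans ?_
  gcongr
  calc K ≤ 1 + K := le_add_self
    _ = (1 + K) ^ 1 := (pow_one _).symm
    _ ≤ (1 + K) ^ 2 := pow_le_pow_right₀ le_self_add (by norm_num)

/-- The error term in the comparison of `commMax b a` with the grand maximal function of
`a * (b - c_B)`. -/
lemma lintegral_enorm_sub_mul_grandMax_le {𝕜 : Type*} [RCLike 𝕜] {n : ℕ} {a b : Rn n → 𝕜}
    {x₀ : Rn n} {r : ℝ} (hb : MemBmo b) (ha : IsAtom a x₀ r) (h0 : r < 1 → ∫ y, a y = 0) :
    ∫⁻ x, ‖b x - bmoConst b x₀ r‖ₑ * grandMax a x ≤ errorConst n * bmoNorm b := by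
  have hr := ha.radius_pos
  set f : Rn n → ℝ≥0∞ := fun x => ‖b x - bmoConst b x₀ r‖ₑ * grandMax a x with hf
  have hbm : AEMeasurable fun x => ‖b x - bmoConst b x₀ r‖ₑ :=
    (hb.aestronglyMeasurable.sub aestronglyMeasurable_const).enorm
  -- Near part: Cauchy–Schwarz, where the factor |B| from b cancels the factor 1/|B| from the atom.
  have hin : ∫⁻ x in ball x₀ (2 * r), f x ≤
      (1 + 2 ^ n * (2 * jnConst n + 2 * (1 + 2 ^ n) ^ 2) * (8 * 6 ^ n)) * bmoNorm b := by
    refine ennreal_le_of_sq_le_mul_sq ?_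
    have hV : volume (ball x₀ r) * (volume (ball x₀ r))⁻¹ = 1 :=
      ENNReal.mul_inv_cancel (volume_ball_ne_zero x₀ hr) (volume_ball_ne_top x₀ r)
    calc _ ≤ _ := lintegral_mul_sq_le hbm.restrict (measurable_grandMax a).aemeasurable
      _ ≤ (2 ^ n * (2 * jnConst n + 2 * (1 + 2 ^ n) ^ 2) * bmoNorm b ^ 2 * volume (ball x₀ r)) *
            (8 * 6 ^ n * (volume (ball x₀ r))⁻¹) := by
          gcongr
          · exact hb.setLIntegral_two_mul_sq_le x₀ hr
          · refine (setLIntegral_le_lintegral _ _).trans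
              ((lintegral_grandMax_sq_le ha.aestronglyMeasurable).trans ?_)
            gcongr
            exact ha.lintegral_sq_le
      _ = 2 ^ n * (2 * jnConst n + 2 * (1 + 2 ^ n) ^ 2) * (8 * 6 ^ n) * bmoNorm b ^ 2 *
            (volume (ball x₀ r) * (volume (ball x₀ r))⁻¹) := by ring
      _ = _ := by rw [hV, mul_one]
  -- Far part: decay 2^(-j) of the maximal function against oscillation of order j; volumes cancel
  -- up to 4^n.
  have hshell : ∀ j : ℕ, ∫⁻ x in ball x₀ (2 ^ (j + 2) * r) \ ball x₀ (2 ^ (j + 1) * r), f x ≤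
      ((2 : ℝ≥0∞) ^ j)⁻¹ * (4 ^ n * (1 + ((j + 2 : ℕ) : ℝ≥0∞) * (1 + 2 ^ n))) * bmoNorm b := by
    intro j
    have hj : 0 < 2 ^ j * r := by positivity
    have hV : (volume (ball x₀ (2 ^ j * r)))⁻¹ * volume (ball x₀ (2 ^ j * r)) = 1 :=
      ENNReal.inv_mul_cancel (volume_ball_ne_zero x₀ hj) (volume_ball_ne_top x₀ _)
    have hV4 : volume (ball x₀ (2 ^ (j + 2) * r)) = 4 ^ n * volume (ball x₀ (2 ^ j * r)) := by
      have := volume_ball_two_pow_mul x₀ 2 (2 ^ j * r)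
      rw [← mul_assoc, ← pow_add, add_comm 2 j] at this
      rw [this]; norm_num
    have h2 : ((2 : ℝ≥0∞) ^ j)⁻¹ ≠ ∞ := ENNReal.inv_ne_top.2 (by positivity)
    have hvi : (volume (ball x₀ (2 ^ j * r)))⁻¹ ≠ ∞ :=
      ENNReal.inv_ne_top.2 (volume_ball_ne_zero x₀ hj)
    calc ∫⁻ x in ball x₀ (2 ^ (j + 2) * r) \ ball x₀ (2 ^ (j + 1) * r), f x
        ≤ ∫⁻ x in ball x₀ (2 ^ (j + 2) * r) \ ball x₀ (2 ^ (j + 1) * r),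
            ‖b x - bmoConst b x₀ r‖ₑ * ((2 ^ j)⁻¹ * (volume (ball x₀ (2 ^ j * r)))⁻¹) :=
          setLIntegral_mono' (measurableSet_ball.diff measurableSet_ball) fun x hx => by
            simp only [hf]
            gcongr
            exact ha.grandMax_le h0 j hx.2
      _ ≤ (∫⁻ x in ball x₀ (2 ^ (j + 2) * r), ‖b x - bmoConst b x₀ r‖ₑ) *
            ((2 ^ j)⁻¹ * (volume (ball x₀ (2 ^ j * r)))⁻¹) := by
          rw [lintegral_mul_const' _ _ (ENNReal.mul_ne_top h2 hvi)]
          gcongr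
          exact Set.sdiff_subset
      _ ≤ ((1 + ((j + 2 : ℕ) : ℝ≥0∞) * (1 + 2 ^ n)) * bmoNorm b *
            (4 ^ n * volume (ball x₀ (2 ^ j * r)))) *
            ((2 ^ j)⁻¹ * (volume (ball x₀ (2 ^ j * r)))⁻¹) := by
          rw [← hV4]
          gcongr
          exact hb.setLIntegral_enorm_sub_le x₀ hr (j + 2)
      _ = ((2 : ℝ≥0∞) ^ j)⁻¹ * (4 ^ n * (1 + ((j + 2 : ℕ) : ℝ≥0∞) * (1 + 2 ^ n))) * bmoNorm b *
            ((volume (ball x₀ (2 ^ j * r)))⁻¹ * volume (ball x₀ (2 ^ j * r))) := by ring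
      _ = _ := by rw [hV, mul_one]
  have hcover : (Set.univ : Set (Rn n)) ⊆ ball x₀ (2 * r) ∪
      ⋃ j : ℕ, ball x₀ (2 ^ (j + 2) * r) \ ball x₀ (2 ^ (j + 1) * r) := by
    intro x _
    have hex : ∃ k : ℕ, x ∈ ball x₀ (2 ^ (k + 1) * r) := by
      obtain ⟨k, hk⟩ := pow_unbounded_of_one_lt (dist x x₀ / r) (by norm_num : (1 : ℝ) < 2)
      refine ⟨k, ?_⟩
      rw [div_lt_iff₀ hr] at hk
      rw [mem_ball, pow_succ]
      have : 0 < (2 : ℝ) ^ k * r := by positivity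
      linarith
    classical
    rcases hk : Nat.find hex with _ | k
    · left
      have := Nat.find_spec hex
      rw [hk] at this
      simpa using this
    · right
      have h1 := Nat.find_spec hex
      rw [hk] at h1
      exact Set.mem_iUnion.2 ⟨k, h1, Nat.find_min hex (by omega)⟩
  calc ∫⁻ x, f x = ∫⁻ x in Set.univ, f x := by rw [Measure.restrict_univ]
    _ ≤ _ := lintegral_mono_set hcover
    _ ≤ _ := lintegral_union_le _ _ _
    _ ≤ _ := add_le_add hin ((lintegral_iUnion_le _ _).trans (ENNReal.tsum_le_tsum hshell))
    _ = _ := by rw [ENNReal.tsum_mul_right, errorConst, ← add_mul]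

/-! ### Lower bounds for the grand maximal function and the logarithmic gain -/

/-- Test functions which are constant, of the largest possible size up to a factor, on the
concentric ball of half the radius. -/
lemma exists_isTestFun (𝕜 : Type*) [RCLike 𝕜] (n : ℕ) : ∃ κ : ℝ, 0 < κ ∧ ∀ (x : Rn n) (t : ℝ),
    0 < t → ∃ φ : Rn n → 𝕜, IsTestFun x t φ ∧
      ∀ y ∈ ball x (t / 2), φ y = ((κ * (volume.real (ball x t))⁻¹ : ℝ) : 𝕜) := by
  let ψ : ContDiffBump (0 : Rn n) := ⟨1 / 2, 3 / 4, by norm_num, by norm_num⟩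
  have hψ : ContDiff ℝ 1 ψ := ψ.contDiff
  obtain ⟨K, hK⟩ := hψ.lipschitzWith_of_hasCompactSupport ψ.hasCompactSupport (by norm_num)
  have hK1 : (0 : ℝ) < 1 + K := by positivity
  -- With K a Lipschitz constant of the bump, dividing by 1 + K secures the size and the gradient
  -- bound at once.
  refine ⟨(1 + (K : ℝ))⁻¹, by positivity, fun x t ht => ?_⟩
  have hv : 0 < volume.real (ball x t) :=
    ENNReal.toReal_pos (volume_ball_ne_zero x ht) (volume_ball_ne_top x t)
  set V := volume.real (ball x t) with hV
  have hdist : ∀ y, dist (t⁻¹ • (y - x)) 0 = t⁻¹ * dist y x := fun y => by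
    rw [dist_zero_right, norm_smul, dist_eq_norm, Real.norm_of_nonneg (by positivity)]
  have hKle : (1 + (K : ℝ))⁻¹ ≤ 1 := inv_le_one_of_one_le₀ (by simp)
  have hKK : (1 + (K : ℝ))⁻¹ * K ≤ 1 := by
    rw [inv_mul_le_iff₀ hK1]; simp
  refine ⟨fun y => (((1 + (K : ℝ))⁻¹ * V⁻¹ * ψ (t⁻¹ • (y - x)) : ℝ) : 𝕜), ⟨?_, ?_, ?_, ?_⟩, ?_⟩
  · have h1 : ContDiff ℝ 1 fun y : Rn n => (1 + (K : ℝ))⁻¹ * V⁻¹ * ψ (t⁻¹ • (y - x)) :=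
      contDiff_const.mul (hψ.comp (by fun_prop : ContDiff ℝ 1 fun y : Rn n => t⁻¹ • (y - x)))
    exact (RCLike.ofRealCLM (K := 𝕜)).contDiff.comp h1
  · refine (closure_minimal (fun y hy => ?_) isClosed_closedBall).trans
      (closedBall_subset_ball (by linarith : 3 / 4 * t < t))
    by_contra hcon
    refine hy ?_
    have : ψ (t⁻¹ • (y - x)) = 0 := by
      refine ψ.zero_of_le_dist ?_
      rw [mem_closedBall, not_le] at hcon
      rw [hdist, inv_mul_eq_div, le_div_iff₀ ht]
      exact hcon.le
    simp [this]
  · intro y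
    rw [RCLike.norm_ofReal, abs_mul, abs_of_nonneg (by positivity : 0 ≤ (1 + (K : ℝ))⁻¹ * V⁻¹),
      abs_of_nonneg ψ.nonneg]
    calc (1 + (K : ℝ))⁻¹ * V⁻¹ * ψ (t⁻¹ • (y - x)) ≤ 1 * V⁻¹ * 1 := by
          gcongr
          · exact ψ.nonneg
          · exact ψ.le_one
      _ = V⁻¹ := by ring
  · intro y
    have hC : 0 ≤ (t * V)⁻¹ := by positivity
    have hlip : LipschitzWith (Real.toNNReal (t * V)⁻¹)
        fun y => (((1 + (K : ℝ))⁻¹ * V⁻¹ * ψ (t⁻¹ • (y - x)) : ℝ) : 𝕜) := by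
      refine LipschitzWith.of_dist_le' fun y z => ?_
      have hd : dist (t⁻¹ • (y - x)) (t⁻¹ • (z - x)) = t⁻¹ * dist y z := by
        rw [dist_smul₀, dist_sub_right, Real.norm_of_nonneg (by positivity)]
      have h1 := hK.dist_le_mul (t⁻¹ • (y - x)) (t⁻¹ • (z - x))
      rw [hd, Real.dist_eq] at h1
      rw [dist_eq_norm, ← RCLike.ofReal_sub, RCLike.norm_ofReal, ← mul_sub, abs_mul,
        abs_of_nonneg (by positivity : 0 ≤ (1 + (K : ℝ))⁻¹ * V⁻¹)]
      calc _ ≤ (1 + (K : ℝ))⁻¹ * V⁻¹ * (K * (t⁻¹ * dist y z)) := by gcongr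
        _ = ((1 + (K : ℝ))⁻¹ * K) * ((t * V)⁻¹ * dist y z) := by rw [mul_inv]; ring
        _ ≤ 1 * ((t * V)⁻¹ * dist y z) := by gcongr
        _ = _ := one_mul _
    have := norm_fderiv_le_of_lipschitz ℝ hlip (x₀ := y)
    rwa [Real.coe_toNNReal _ hC] at this
  · intro y hy
    have : ψ (t⁻¹ • (y - x)) = 1 := by
      refine ψ.one_of_mem_closedBall ?_
      rw [mem_closedBall, hdist, inv_mul_eq_div, div_le_iff₀ ht]
      have := mem_ball.1 hy
      show dist y x ≤ 1 / 2 * t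
      linarith
    simp [this]

/-- The plateau at scale 4ρ around x is a ball of radius 2ρ, which contains the support of f because
|x - x₀| < ρ and r ≤ ρ. Pairing with it returns a multiple of ∫f. -/
lemma exists_le_grandMax_mul_volume (𝕜 : Type*) [RCLike 𝕜] (n : ℕ) :
    ∃ κ : ℝ≥0∞, κ ≠ 0 ∧ κ ≠ ∞ ∧ ∀ (f : Rn n → 𝕜) (x₀ x : Rn n) (r ρ : ℝ), 0 < ρ → r ≤ ρ →
      4 * ρ < 1 → (∀ᵐ y, y ∉ ball x₀ r → f y = 0) → x ∈ ball x₀ ρ →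
      κ * ‖∫ y, f y‖ₑ ≤ grandMax f x * volume (ball x₀ (4 * ρ)) := by
  obtain ⟨κ, hκ, h⟩ := exists_isTestFun 𝕜 n
  refine ⟨ENNReal.ofReal κ, (ENNReal.ofReal_pos.2 hκ).ne', ENNReal.ofReal_ne_top,
    fun f x₀ x r ρ hρ hr hρ1 hf hx => ?_⟩
  obtain ⟨φ, hφ, hφ1⟩ := h x (4 * ρ) (by positivity)
  have h0 := volume_ball_ne_zero x (by positivity : 0 < 4 * ρ)
  have hv : 0 < volume.real (ball x (4 * ρ)) := ENNReal.toReal_pos h0 (volume_ball_ne_top x _)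
  have hint : ∫ y, f y * φ y =
      (∫ y, f y) * ((κ * (volume.real (ball x (4 * ρ)))⁻¹ : ℝ) : 𝕜) := by
    rw [← integral_mul_const]
    refine integral_congr_ae ?_
    filter_upwards [hf] with y hy
    by_cases hyB : y ∈ ball x₀ r
    · rw [hφ1 y]
      have h1 := mem_ball.1 hyB
      have h2 := mem_ball'.1 hx
      rw [mem_ball]
      linarith [dist_triangle y x₀ x]
    · rw [hy hyB]; simp
  have hle : ‖∫ y, f y * φ y‖ₑ ≤ grandMax f x :=
    le_iSup_of_le (4 * ρ) (le_iSup_of_le ⟨by positivity, hρ1⟩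
      (le_iSup_of_le φ (le_iSup_of_le hφ le_rfl)))
  rw [volume_ball_eq x₀ x, ← ENNReal.div_le_iff h0 (volume_ball_ne_top x _)]
  refine le_trans (le_of_eq ?_) hle
  rw [hint, enorm_mul, ← ofReal_norm (((κ * (volume.real (ball x (4 * ρ)))⁻¹ : ℝ) : 𝕜)),
    RCLike.norm_ofReal, abs_of_pos (by positivity), ENNReal.ofReal_mul hκ.le,
    ENNReal.ofReal_inv_of_pos hv, Measure.real, ENNReal.ofReal_toReal (volume_ball_ne_top x _),
    div_eq_mul_inv]
  ring

/-- A function supported in a ball of radius `r` has integral at most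
`O(‖f‖_{h¹} / log (1 + r⁻¹))`, up to its trivial bound for large radii. -/
lemma exists_log_mul_enorm_integral_le (𝕜 : Type*) [RCLike 𝕜] (n : ℕ) (hn : 1 ≤ n) :
    ∃ D : ℝ≥0∞, D ≠ ∞ ∧ ∀ (f : Rn n → 𝕜) (x₀ : Rn n) (r : ℝ), 0 < r →
      (∀ᵐ y, y ∉ ball x₀ r → f y = 0) →
      ENNReal.ofReal (Real.log (1 + r⁻¹)) * ‖∫ y, f y‖ₑ ≤ D * hardyNorm f + 4 * ‖∫ y, f y‖ₑ := by
  obtain ⟨κ, hκ0, hκt, h⟩ := exists_le_grandMax_mul_volume 𝕜 n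
  refine ⟨κ⁻¹ * 8 ^ n, ENNReal.mul_ne_top (ENNReal.inv_ne_top.2 hκ0) (by finiteness),
    fun f x₀ r hr hf => ?_⟩
  -- Each dyadic annulus carries a fixed share of |∫f|, as long as the test scale stays below 1. The
  -- alternative m = 0 covers large r, where no annulus is available.
  have hind : ∀ m : ℕ, (m = 0 ∨ 2 ^ (m + 2) * r < 1) →
      m * (κ * ‖∫ y, f y‖ₑ) ≤ 8 ^ n * ∫⁻ x in ball x₀ (2 ^ m * r), grandMax f x := by
    intro m
    induction m with
    | zero => intro _; simp
    | succ m ih =>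
      intro hm
      have hm : 2 ^ (m + 1 + 2) * r < 1 := by simpa using hm
      have hm0 : 0 < 2 ^ m * r := by positivity
      have hstep : κ * ‖∫ y, f y‖ₑ ≤
          8 ^ n * ∫⁻ x in ball x₀ (2 ^ (m + 1) * r) \ ball x₀ (2 ^ m * r), grandMax f x := by
        set S := ball x₀ (2 ^ (m + 1) * r) \ ball x₀ (2 ^ m * r) with hS
        have hV0 := volume_ball_ne_zero x₀ hm0
        have hVt := volume_ball_ne_top x₀ (2 ^ m * r)
        -- The annulus is at least as large as the inner ball because 2^n ≥ 2; this uses n ≥ 1.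
        have hSV : volume (ball x₀ (2 ^ m * r)) ≤ volume S := by
          rw [hS, measure_sdiff (ball_subset_ball (by rw [pow_succ]; linarith))
            measurableSet_ball.nullMeasurableSet hVt]
          refine ENNReal.le_sub_of_add_le_left hVt ?_
          have := volume_ball_two_pow_mul x₀ 1 (2 ^ m * r)
          rw [← mul_assoc, ← pow_add, add_comm 1 m, pow_one] at this
          rw [this, ← two_mul]
          gcongr
          exact le_self_pow₀ (by norm_num) (by omega)
        have hV8 : volume (ball x₀ (4 * (2 ^ (m + 1) * r))) =
            8 ^ n * volume (ball x₀ (2 ^ m * r)) := by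
          have := volume_ball_two_pow_mul x₀ 3 (2 ^ m * r)
          rw [show (4 : ℝ) * (2 ^ (m + 1) * r) = 2 ^ 3 * (2 ^ m * r) by ring, this]
          norm_num
        rw [← ENNReal.mul_le_mul_iff_left hV0 hVt]
        calc κ * ‖∫ y, f y‖ₑ * volume (ball x₀ (2 ^ m * r))
            ≤ κ * ‖∫ y, f y‖ₑ * volume S := by gcongr
          _ = ∫⁻ x in S, κ * ‖∫ y, f y‖ₑ := by rw [setLIntegral_const]
          _ ≤ ∫⁻ x in S, grandMax f x * volume (ball x₀ (4 * (2 ^ (m + 1) * r))) := by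
              refine setLIntegral_mono' (measurableSet_ball.diff measurableSet_ball)
                fun x hx => h f x₀ x r _ (by positivity) ?_ ?_ hf hx.1
              · exact le_mul_of_one_le_left hr.le (one_le_pow₀ (by norm_num))
              · calc 4 * (2 ^ (m + 1) * r) = 2 ^ (m + 1 + 2) * r := by ring
                  _ < 1 := hm
          _ = 8 ^ n * (∫⁻ x in S, grandMax f x) * volume (ball x₀ (2 ^ m * r)) := by
              rw [lintegral_mul_const' _ _ (volume_ball_ne_top x₀ _), hV8]; ring
      have hih := ih (Or.inr (by rw [show m + 1 + 2 = (m + 2) + 1 by ring, pow_succ] at hm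
                                 have : 0 < 2 ^ (m + 2) * r := by positivity
                                 linarith))
      have hunion : ball x₀ (2 ^ (m + 1) * r) =
          ball x₀ (2 ^ m * r) ∪ (ball x₀ (2 ^ (m + 1) * r) \ ball x₀ (2 ^ m * r)) := by
        rw [Set.union_sdiff_cancel]
        exact ball_subset_ball (by rw [pow_succ]; linarith)
      rw [hunion, lintegral_union (measurableSet_ball.diff measurableSet_ball)
        Set.disjoint_sdiff_right, mul_add]
      calc _ = m * (κ * ‖∫ y, f y‖ₑ) + κ * ‖∫ y, f y‖ₑ := by push_cast; ring
        _ ≤ _ := add_le_add hih hstep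
  -- The least m with 2^(m+3) r ≥ 1, so by minimality all m annuli are admissible. Then 1 + 1/r ≤
  -- 2^(m+4), and the surplus 4 over m is the source of the term 4|∫f|.
  obtain ⟨m, hm1, hm2⟩ : ∃ m : ℕ, 1 ≤ 2 ^ (m + 3) * r ∧ (m = 0 ∨ 2 ^ (m + 2) * r < 1) := by
    have hex : ∃ m : ℕ, 1 ≤ 2 ^ (m + 3) * r := by
      obtain ⟨m, hm⟩ := pow_unbounded_of_one_lt (1 / r) (by norm_num : (1 : ℝ) < 2)
      rw [div_lt_iff₀ hr] at hm
      refine ⟨m, hm.le.trans ?_⟩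
      gcongr <;> norm_num
    classical
    refine ⟨Nat.find hex, Nat.find_spec hex, ?_⟩
    rcases hk : Nat.find hex with _ | k
    · exact Or.inl rfl
    · exact Or.inr (not_le.1 (Nat.find_min hex (m := k) (by omega)))
  have hlog : Real.log (1 + r⁻¹) ≤ m + 4 := by
    have h1 : r⁻¹ ≤ 2 ^ (m + 3) := by
      rwa [inv_le_iff_one_le_mul₀ hr]
    have h2 : (1 : ℝ) ≤ 2 ^ (m + 3) := one_le_pow₀ (by norm_num)
    have h3 : 1 + r⁻¹ ≤ 2 ^ (m + 4) := by rw [pow_succ]; linarith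
    calc Real.log (1 + r⁻¹) ≤ Real.log (2 ^ (m + 4)) := Real.log_le_log (by positivity) h3
      _ = (m + 4) * Real.log 2 := by rw [Real.log_pow]; push_cast; ring
      _ ≤ (m + 4) * 1 := by
          gcongr
          linarith [Real.log_two_lt_d9]
      _ = m + 4 := mul_one _
  have hm := hind m hm2
  calc ENNReal.ofReal (Real.log (1 + r⁻¹)) * ‖∫ y, f y‖ₑ ≤ (m + 4) * ‖∫ y, f y‖ₑ := by
        gcongr
        refine (ENNReal.ofReal_le_ofReal hlog).trans_eq ?_
        rw [ENNReal.ofReal_add (by positivity) (by norm_num), ENNReal.ofReal_natCast,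
          ENNReal.ofReal_ofNat]
    _ = κ⁻¹ * (m * (κ * ‖∫ y, f y‖ₑ)) + 4 * ‖∫ y, f y‖ₑ := by
        have : κ⁻¹ * (m * (κ * ‖∫ y, f y‖ₑ)) = (κ⁻¹ * κ) * (m * ‖∫ y, f y‖ₑ) := by ring
        rw [this, ENNReal.inv_mul_cancel hκ0 hκt]; ring
    _ ≤ κ⁻¹ * (8 ^ n * hardyNorm f) + 4 * ‖∫ y, f y‖ₑ := by
        gcongr κ⁻¹ * ?_ + _
        exact hm.trans (mul_le_mul_right (setLIntegral_le_lintegral _ _) _)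
    _ = _ := by rw [mul_assoc]

/-! ### Comparison of the two maximal functions and conclusion -/

lemma IsAtom.lintegral_enorm_mul_sub_le {𝕜 : Type*} [RCLike 𝕜] {n : ℕ} {a b : Rn n → 𝕜}
    {x₀ : Rn n} {r : ℝ} (ha : IsAtom a x₀ r) (hb : MemBmo b) :
    ∫⁻ y, ‖a y * (b y - bmoConst b x₀ r)‖ₑ ≤ (1 + jnConst n) * bmoNorm b := by
  simp only [enorm_mul]
  refine ennreal_le_of_sq_le_mul_sq ?_
  calc _ ≤ _ := ha.lintegral_mul_sq_le
        (hb.aestronglyMeasurable.sub aestronglyMeasurable_const).enorm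
    _ ≤ (volume (ball x₀ r))⁻¹ * (jnConst n * bmoNorm b ^ 2 * volume (ball x₀ r)) := by
        gcongr
        exact hb.setLIntegral_sq_le x₀ ha.radius_pos
    _ = jnConst n * bmoNorm b ^ 2 * ((volume (ball x₀ r))⁻¹ * volume (ball x₀ r)) := by ring
    _ = _ := by
        rw [ENNReal.inv_mul_cancel (volume_ball_ne_zero x₀ ha.radius_pos) (volume_ball_ne_top x₀ r),
          mul_one]

lemma IsAtom.integrable_mul_sub {𝕜 : Type*} [RCLike 𝕜] {n : ℕ} {a b : Rn n → 𝕜}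
    {x₀ : Rn n} {r : ℝ} (ha : IsAtom a x₀ r) (hb : MemBmo b) :
    Integrable fun y => a y * (b y - bmoConst b x₀ r) :=
  ⟨ha.aestronglyMeasurable.mul (hb.aestronglyMeasurable.sub aestronglyMeasurable_const),
    (ha.lintegral_enorm_mul_sub_le hb).trans_lt
      (ENNReal.mul_lt_top (ENNReal.add_lt_top.2 ⟨by norm_num, (jnConst_ne_top n).lt_top⟩) hb.2)⟩

lemma IsTestFun.integrable_mul {𝕜 : Type*} [RCLike 𝕜] {n : ℕ} {x : Rn n} {t : ℝ} {f φ : Rn n → 𝕜}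
    (hφ : IsTestFun x t φ) (hf : Integrable f) : Integrable fun y => f y * φ y :=
  hf.mul_bdd hφ.1.continuous.aestronglyMeasurable (Filter.Eventually.of_forall hφ.2.2.1)

lemma IsTestFun.enorm_integral_le_grandMax {𝕜 : Type*} [RCLike 𝕜] {n : ℕ} {x : Rn n} {t : ℝ}
    {φ : Rn n → 𝕜} (hφ : IsTestFun x t φ) (ht : 0 < t ∧ t < 1) (f : Rn n → 𝕜) :
    ‖∫ y, f y * φ y‖ₑ ≤ grandMax f x :=
  le_iSup_of_le t (le_iSup_of_le ht (le_iSup_of_le φ (le_iSup_of_le hφ le_rfl)))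

lemma IsTestFun.integral_comm_mul {𝕜 : Type*} [RCLike 𝕜] {n : ℕ} {x : Rn n} {t : ℝ}
    {a b φ : Rn n → 𝕜} (hφ : IsTestFun x t φ) (c : 𝕜) (ha : Integrable a)
    (hab : Integrable fun y => a y * (b y - c)) :
    ∫ y, (b x * a y - b y * a y) * φ y =
      (b x - c) * (∫ y, a y * φ y) - ∫ y, a y * (b y - c) * φ y := by
  rw [← integral_const_mul, ← integral_sub ((hφ.integrable_mul ha).const_mul _)
    (hφ.integrable_mul hab)]
  exact integral_congr_ae (Filter.Eventually.of_forall fun y => by ring)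

lemma commMax_le {𝕜 : Type*} [RCLike 𝕜] {n : ℕ} {a b : Rn n → 𝕜} (c : 𝕜) (ha : Integrable a)
    (hab : Integrable fun y => a y * (b y - c)) (x : Rn n) :
    commMax b a x ≤ grandMax (fun y => a y * (b y - c)) x + ‖b x - c‖ₑ * grandMax a x := by
  refine iSup_le fun t => iSup_le fun ht => iSup_le fun φ => iSup_le fun hφ => ?_
  rw [hφ.integral_comm_mul c ha hab]
  refine enorm_sub_le.trans ?_
  rw [enorm_mul, add_comm]
  gcongr
  · exact hφ.enorm_integral_le_grandMax ht fun y => a y * (b y - c)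
  · exact hφ.enorm_integral_le_grandMax ht a

lemma grandMax_mul_sub_le {𝕜 : Type*} [RCLike 𝕜] {n : ℕ} {a b : Rn n → 𝕜} (c : 𝕜)
    (ha : Integrable a) (hab : Integrable fun y => a y * (b y - c)) (x : Rn n) :
    grandMax (fun y => a y * (b y - c)) x ≤ commMax b a x + ‖b x - c‖ₑ * grandMax a x := by
  refine iSup_le fun t => iSup_le fun ht => iSup_le fun φ => iSup_le fun hφ => ?_
  have h : ∫ y, a y * (b y - c) * φ y =
      (b x - c) * (∫ y, a y * φ y) - ∫ y, (b x * a y - b y * a y) * φ y := by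
    rw [hφ.integral_comm_mul c ha hab]; ring
  rw [h]
  refine enorm_sub_le.trans ?_
  rw [enorm_mul, add_comm]
  gcongr
  · exact hφ.enorm_integral_le_grandMax ht fun y => b x * a y - b y * a y
  · exact hφ.enorm_integral_le_grandMax ht a

lemma lintegral_commMax_le {𝕜 : Type*} [RCLike 𝕜] {n : ℕ} {a b : Rn n → 𝕜}
    {x₀ : Rn n} {r : ℝ} (hb : MemBmo b) (ha : IsAtom a x₀ r) (h0 : r < 1 → ∫ y, a y = 0) :
    ∫⁻ x, commMax b a x ≤
      hardyNorm (fun y => a y * (b y - bmoConst b x₀ r)) + errorConst n * bmoNorm b := by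
  calc _ ≤ _ := lintegral_mono (commMax_le (bmoConst b x₀ r) ha.integrable
        (ha.integrable_mul_sub hb))
    _ = _ := lintegral_add_left (measurable_grandMax _) _
    _ ≤ _ := add_le_add_right (lintegral_enorm_sub_mul_grandMax_le hb ha h0) _

lemma hardyNorm_mul_sub_le {𝕜 : Type*} [RCLike 𝕜] {n : ℕ} {a b : Rn n → 𝕜}
    {x₀ : Rn n} {r : ℝ} (hb : MemBmo b) (ha : IsAtom a x₀ r) (h0 : r < 1 → ∫ y, a y = 0) :
    hardyNorm (fun y => a y * (b y - bmoConst b x₀ r)) ≤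
      (∫⁻ x, commMax b a x) + errorConst n * bmoNorm b := by
  have hm : AEMeasurable fun x => ‖b x - bmoConst b x₀ r‖ₑ * grandMax a x :=
    (hb.aestronglyMeasurable.sub aestronglyMeasurable_const).enorm.mul
      (measurable_grandMax a).aemeasurable
  calc _ ≤ _ := lintegral_mono (grandMax_mul_sub_le (bmoConst b x₀ r) ha.integrable
        (ha.integrable_mul_sub hb))
    _ = _ := lintegral_add_right' _ hm
    _ ≤ _ := add_le_add_right (lintegral_enorm_sub_mul_grandMax_le hb ha h0) _

lemma IsAtom.integrable_mul {𝕜 : Type*} [RCLike 𝕜] {n : ℕ} {a b : Rn n → 𝕜}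
    {x₀ : Rn n} {r : ℝ} (ha : IsAtom a x₀ r) (hb : MemBmo b) :
    Integrable fun y => a y * b y :=
  ((ha.integrable_mul_sub hb).add (ha.integrable.mul_const (bmoConst b x₀ r))).congr
    (Filter.Eventually.of_forall fun y => by simp only [Pi.add_apply]; ring)

/-- For r < 1 the atom has integral zero; for r ≥ 1 the constant c_B is zero. -/
lemma IsAtom.integral_mul_eq {𝕜 : Type*} [RCLike 𝕜] {n : ℕ} {a b : Rn n → 𝕜}
    {x₀ : Rn n} {r : ℝ} (ha : IsAtom a x₀ r) (hb : MemBmo b) (h0 : r < 1 → ∫ y, a y = 0) :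
    ∫ y, a y * b y = ∫ y, a y * (b y - bmoConst b x₀ r) := by
  simp_rw [mul_sub]
  rw [integral_sub (ha.integrable_mul hb) (ha.integrable.mul_const _), integral_mul_const]
  by_cases hr : r < 1
  · simp [h0 hr]
  · simp [bmoConst, hr]

end LocalHardy

theorem proposition4p7 (𝕜 : Type*) [RCLike 𝕜] (n : ℕ) (hn : 1 ≤ n) :
    ∃ C : NNReal, ∀ (b a : LocalHardy.Rn n → 𝕜) (x₀ : LocalHardy.Rn n) (r : ℝ),
      LocalHardy.MemBmo b →
      LocalHardy.IsAtom a x₀ r →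
      (r < 1 → ∫ y, a y = 0) →
      ((∫⁻ x, LocalHardy.commMax b a x) ≤
          C * (LocalHardy.hardyNorm (fun y => a y * (b y - LocalHardy.bmoConst b x₀ r))
            + LocalHardy.bmoNorm b)) ∧
      (LocalHardy.hardyNorm (fun y => a y * (b y - LocalHardy.bmoConst b x₀ r))
            + LocalHardy.bmoNorm b ≤
          C * ((∫⁻ x, LocalHardy.commMax b a x) + LocalHardy.bmoNorm b)) ∧
      Integrable (fun y => a y * b y) volume ∧
      ‖∫ y, a y * b y‖ₑ ≤
        C * min
          (((∫⁻ x, LocalHardy.commMax b a x) + LocalHardy.bmoNorm b)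
            / ENNReal.ofReal (Real.log (1 + r⁻¹)))
          (LocalHardy.bmoNorm b) := by
  obtain ⟨D, hD, hlog⟩ := LocalHardy.exists_log_mul_enorm_integral_le 𝕜 n hn
  have hE := LocalHardy.errorConst_ne_top n
  have hJ := LocalHardy.jnConst_ne_top n
  set E := LocalHardy.errorConst n
  set J := LocalHardy.jnConst n
  -- The sum of the constants required by the separate estimates; each bound below follows by adding
  -- nonnegative leftover terms.
  obtain ⟨C, hC⟩ : ∃ C : NNReal, (C : ℝ≥0∞) = 1 + E + D + D * E + 4 * (1 + J) :=
    ⟨_, ENNReal.coe_toNNReal (by finiteness)⟩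
  refine ⟨C, fun b a x₀ r hb ha h0 => ?_⟩
  have h1 := LocalHardy.lintegral_commMax_le hb ha h0
  have h2 := LocalHardy.hardyNorm_mul_sub_le hb ha h0
  have h3 := (enorm_integral_le_lintegral_enorm _).trans (ha.lintegral_enorm_mul_sub_le hb)
  have h4 := hlog (fun y => a y * (b y - LocalHardy.bmoConst b x₀ r)) x₀ r ha.radius_pos
    (by filter_upwards [ha.support] with y hy hyB; simp [hy hyB])
  rw [ha.integral_mul_eq hb h0]
  set A := LocalHardy.bmoNorm b
  set H := LocalHardy.hardyNorm fun y => a y * (b y - LocalHardy.bmoConst b x₀ r)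
  set M := ∫⁻ x, LocalHardy.commMax b a x
  set I := ‖∫ y, a y * (b y - LocalHardy.bmoConst b x₀ r)‖ₑ
  have hr := ha.radius_pos
  have hpos : 0 < Real.log (1 + r⁻¹) := Real.log_pos (by linarith [inv_pos.2 hr])
  refine ⟨?_, ?_, ha.integrable_mul hb, ?_⟩
  · calc M ≤ H + E * A := h1
      _ ≤ (H + E * A) + (A + (D + D * E + 4 * (1 + J)) * (H + A) + E * H) := le_self_add
      _ = C * (H + A) := by rw [hC]; ring
  · calc H + A ≤ (M + E * A) + A := by gcongr
      _ ≤ (M + E * A) + A + ((D + D * E + 4 * (1 + J)) * (M + A) + E * M) := le_self_add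
      _ = C * (M + A) := by rw [hC]; ring
  · rw [mul_min]
    refine le_min ?_ ?_
    · rw [← mul_div_assoc, ENNReal.le_div_iff_mul_le
        (Or.inl (ENNReal.ofReal_pos.2 hpos).ne') (Or.inl ENNReal.ofReal_ne_top), mul_comm I]
      -- The trivial term 4|∫ab| is absorbed by the bmo norm, and the h¹ norm is traded for the
      -- commutator norm.
      calc _ ≤ D * H + 4 * I := h4
        _ ≤ D * (M + E * A) + 4 * ((1 + J) * A) := by gcongr
        _ ≤ D * (M + E * A) + 4 * ((1 + J) * A) +
            ((1 + E) * (M + A) + D * A + D * E * M + 4 * (1 + J) * M) := le_self_add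
        _ = C * (M + A) := by rw [hC]; ring
    · calc I ≤ (1 + J) * A := h3
        _ ≤ (1 + J) * A + ((1 + E + D + D * E) * A + 3 * ((1 + J) * A)) := le_self_add
        _ = C * A := by rw [hC]; ring
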